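/- **Network.** A $K$-user layered network is a finite directed graph $(\mathcal V,\mathcal E)$ whose nodes are partitioned into layers $\mathcal V_1,\dots,\mathcal V_L$, $L\ge 2$, with every edge going from some $\mathcal V_l$ to $\mathcal V_{l+1}$; $\mathcal V_1=\{S_1,\dots,S_K\}$ are the sources, $\mathcal V_L=\{D_1,\dots,D_K\}$ the destinations, the other nodes are relays. A network state assigns a gain to every edge (gain $0$ is allowed). - *Linear deterministic model:* gains $n_{uv}\in\mathbb Z_{\ge0}$ with maximum $q$; inputs and outputs lie in $\mathbb F_2^q$ and $Y_v[t]=\sum_{(u,v)\in\mathcal E}\mathbf S^{q-n_{uv}}X_u[t]$, where $\mathbf S$ is the $q\times q$ shift matrix. - *Gaussian model:* gains $h_{uv}\in\mathbb C$ and $Y_v[t]=\sum_{(u,v)\in\mathcal E}h_{uv}X_u[t]+Z_v[t]$, with $Z_v[t]$ i.i.d. circularly symmetric complex Gaussian of unit variance, and with the power constraint $\limsup_{N\to\infty}\frac1N\mathbb E\sum_{t\le N}|X_v[t]|^2\le 1$ at every node. **$1$-local view.** All nodes know $(\mathcal V,\mathcal E)$ (and, in the deterministic model, the signal length $q$). The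 route-adjacency graph is the bipartite graph that joins $S_i$ and $D_j$ whenever there is a route (directed path) from $S_i$ to $D_j$. The source $S_i$ knows the gains of the edges that lie on a route from some $S_j$ to some $D_k$, where $S_j$ and $D_k$ are at most one hop away from $S_i$ in the route-adjacency graph; any other node knows the union of what is known to the sources that have a route to it. **Codes.** For each $N$, source $S_i$ encodes a uniform message $W_i\in\{1,\dots,\lfloor 2^{NR_i}\rfloor\}$ (independent for different $i$) into $N$ inputs, each relay computes its input at time $t$ from its outputs at times before $t$, and $D_i$ decodes $W_i$ from its $N$ outputs. A sequence of codes with rates $R_i\ge 0$ is reliable in a state if all error probabilities tend to $0$ as $N\to\infty$ (and, in the Gaussian model, the power constraint holds). $C_{\rm sum}$ is the supremum, for a given state, of $\sum_iR_i$ over all reliable sequences of codes (full network knowledge). A normalized sum-rate $\alpha$ is achievable with $1$-local view if there are a constant $\tau$ independent of the channel gains and strategies in which the rate and encoder of each source, the encoding functions of each relay and the decoder of each destination depend only on what that node knows, such that in every state the codes are reliable and $\sum_iR_i\ge\alpha C_{\rm sum}-\tau$. The normalized sum-capacity $\alpha^*$ is the supremum of the achievable $\alpha$. **Lemma.** If for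 some $i\ne j$ there is a path from $S_i$ to $D_j$, each of whose nodes lies on a route from some source $S_k$ to its own destination $D_k$, then $\alpha^*\le\frac12$, in the linear deterministic model and in the Gaussian model. -/

import Mathlib

open scoped ENNReal
open MeasureTheory ProbabilityTheory Filter Topology

/-! ### Layered networks -/

/-- The nodes of a network with `K` source-destination pairs and relays indexed by `ρ`. -/
inductive Node (K : ℕ) (ρ : Type*) where
  | src (i : Fin K) : Node K ρ
  | relay (r : ρ) : Node K ρ
  | dst (i : Fin K) : Node K ρ
  deriving DecidableEq, Fintype

/-- The topology of a `K`-user layered network: the nodes are partitioned into layers `1, …, L`,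
the first layer consists of the `K` sources, the last one of the `K` destinations, and every
directed edge goes from a layer to the next one. `L = 2` is a single-hop network. -/
structure LayeredNetwork (K : ℕ) (ρ : Type*) where
  /-- the number of layers of nodes -/
  L : ℕ
  two_le : 2 ≤ L
  /-- the layer of each relay -/
  relayLayer : ρ → ℕ
  relayLayer_gt : ∀ r, 1 < relayLayer r
  relayLayer_lt : ∀ r, relayLayer r < L
  /-- the directed edges -/
  Adj : Node K ρ → Node K ρ → Prop
  adj_layer : ∀ u v, Adj u v →
    (match v with | .src _ => 1 | .relay r => relayLayer r | .dst _ => L) =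
      (match u with | .src _ => 1 | .relay r => relayLayer r | .dst _ => L) + 1

namespace LayeredNetwork

variable {K : ℕ} {ρ : Type*} (net : LayeredNetwork K ρ)

/-- The set of directed edges. -/
abbrev Edge : Type _ := {e : Node K ρ × Node K ρ // net.Adj e.1 e.2}

noncomputable instance [Fintype ρ] : Fintype net.Edge := Fintype.ofFinite _

/-- `p` lists the nodes of a route from `s` to `d` in order. -/
def IsRoute (s d : Node K ρ) (p : List (Node K ρ)) : Prop :=
  p.IsChain net.Adj ∧ p.head? = some s ∧ p.getLast? = some d

/-- There is a route from `s` to `d`. -/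
def HasRoute (s d : Node K ρ) : Prop := ∃ p, net.IsRoute s d p

/-- `v` is a node of the induced subgraph `𝒢_{ij}`: it lies on a route from `S_i` to `D_j`. -/
def OnRoute (i j : Fin K) (v : Node K ρ) : Prop :=
  ∃ p, net.IsRoute (.src i) (.dst j) p ∧ v ∈ p

/-- The link `e` is traversed by a route from `S_i` to `D_j`. -/
def EdgeOnRoute (i j : Fin K) (e : net.Edge) : Prop :=
  ∃ p, net.IsRoute (.src i) (.dst j) p ∧ [e.1.1, e.1.2] <:+: p

/-! ### Local views -/

/-- The route-adjacency graph: the undirected bipartite graph with the sources (`Sum.inl`) on one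
side, the destinations (`Sum.inr`) on the other, and an edge between `S_i` and `D_j` whenever there
is a route from `S_i` to `D_j`. -/
def routeAdjacencyGraph : SimpleGraph (Fin K ⊕ Fin K) :=
  SimpleGraph.fromRel fun a b => ∃ i j, a = Sum.inl i ∧ b = Sum.inr j ∧
    net.HasRoute (.src i) (.dst j)

/-- The links whose gains the source `S_i` knows with `h`-local view: those on a route from some
`S_j` to some `D_k` where `S_j` and `D_k` are at most `h` hops away from `S_i` in the
route-adjacency graph. -/
def sourceView (h : ℕ) (i : Fin K) : Set net.Edge :=
  {e | ∃ j k, net.routeAdjacencyGraph.edist (Sum.inl i) (Sum.inl j) ≤ h ∧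
    net.routeAdjacencyGraph.edist (Sum.inl i) (Sum.inr k) ≤ h ∧ net.EdgeOnRoute j k e}

/-- The links whose gains a node knows with `h`-local view: a node that is not a source has the
union of the information of all sources that have a route to it. -/
def view (h : ℕ) : Node K ρ → Set net.Edge
  | .src i => net.sourceView h i
  | v => {e | ∃ i, net.HasRoute (.src i) v ∧ e ∈ net.sourceView h i}

/-- The gain assignments `g` and `g'` look the same to the node `v`. -/
def SameView (h : ℕ) {G : Type*} (v : Node K ρ) (g g' : net.Edge → G) : Prop :=
  ∀ e ∈ net.view h v, g e = g' e

end LayeredNetwork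

/-! ### Codes -/

/-- The encoding functions of the sources, the encoding functions of the relays and the decoding
functions of the destinations for `N` channel uses with signals in `A`. The time instants are
`t = 0, …, N - 1`, and messages are numbered from `0`. At time `t` a relay applies its function to
the `t` signals it has received before. -/
structure NetCode (K : ℕ) (ρ : Type*) (A : Type*) (N : ℕ) where
  enc : Fin K → ℕ → ℕ → A
  relay : ρ → (t : ℕ) → (Fin t → A) → A
  dec : Fin K → (Fin N → A) → ℕ

namespace NetCode

variable {K : ℕ} {ρ : Type*} {A : Type*} {N : ℕ} [Zero A]

/-- The channel input of a node at time `t` when the messages are `m` and the node has received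
`y` so far. Destinations do not transmit. -/
def send (c : NetCode K ρ A N) (m : Fin K → ℕ) (t : ℕ) : (u : Node K ρ) → (Fin t → A) → A
  | .src i, _ => c.enc i (m i) t
  | .relay r, y => c.relay r t y
  | .dst _, _ => 0

/-- The first `t` received signals of each node, when `recv t X v` is the signal received by `v` at
time `t` if the channel inputs at time `t` are `X`. -/
def received (c : NetCode K ρ A N) (recv : ℕ → (Node K ρ → A) → Node K ρ → A) (m : Fin K → ℕ) :
    (t : ℕ) → Node K ρ → Fin t → A
  | 0, _ => Fin.elim0
  | t + 1, v => Fin.snoc (α := fun _ => A) (c.received recv m t v)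
      (recv t (fun u => c.send m t u (c.received recv m t u)) v)

/-- The channel input of the node `v` at time `t`. -/
def input (c : NetCode K ρ A N) (recv : ℕ → (Node K ρ → A) → Node K ρ → A) (m : Fin K → ℕ)
    (t : ℕ) (v : Node K ρ) : A :=
  c.send m t v (c.received recv m t v)

/-- The estimate that the destination `D_i` makes of the message of `S_i`. -/
def decoded (c : NetCode K ρ A N) (recv : ℕ → (Node K ρ → A) → Node K ρ → A) (m : Fin K → ℕ)
    (i : Fin K) : ℕ :=
  c.dec i (c.received recv m N (.dst i))

end NetCode

/-- The tuples of messages at rates `R` and block length `N`: the `i`-th message takes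
`⌊2 ^ (N R_i)⌋` values. The messages are independent and uniform, so that the tuple is uniform on
this set. -/
noncomputable def messages {K : ℕ} (N : ℕ) (R : Fin K → ℝ) : Finset (Fin K → ℕ) :=
  Fintype.piFinset fun i => Finset.range ⌊(2 : ℝ) ^ (N * R i)⌋₊

/-! ### The linear deterministic model -/

namespace LinDet

variable {K : ℕ} {ρ : Type*} [Fintype ρ] (net : LayeredNetwork K ρ)

/-- The `q × q` shift matrix over `𝔽₂`, with ones just below the diagonal. -/
def shift (q : ℕ) : Matrix (Fin q) (Fin q) (ZMod 2) :=
  Matrix.of fun a b => if (a : ℕ) = b + 1 then 1 else 0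

/-- The network states whose largest channel gain is `q`. -/
def State (q : ℕ) : Type _ := {n : net.Edge → ℕ // Finset.univ.sup n = q}

variable {net} {q : ℕ}

open Classical in
/-- The received signals `Y_v = ∑_{(u, v) ∈ ℰ} 𝐒^(q - n_{uv}) X_u`. -/
noncomputable def recv (n : State net q) (X : Node K ρ → Fin q → ZMod 2) (v : Node K ρ) :
    Fin q → ZMod 2 :=
  ∑ e : net.Edge with e.1.2 = v, (shift q ^ (q - n.1 e)).mulVec (X e.1.1)

/-- The probability `λ_i` that `D_i` decodes the message of `S_i` wrongly. -/
noncomputable def errorProb (n : State net q) {N : ℕ} (c : NetCode K ρ (Fin q → ZMod 2) N)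
    (R : Fin K → ℝ) (i : Fin K) : ℝ :=
  ((messages N R).filter fun m => c.decoded (fun _ => recv n) m i ≠ m i).card /
    (messages N R).card

/-- In the state `n`, the sequence `c` of codes has rates `R` and all its error probabilities tend
to zero. -/
def Reliable (n : State net q) (c : (N : ℕ) → NetCode K ρ (Fin q → ZMod 2) N) (R : Fin K → ℝ) :
    Prop :=
  (∀ i, 0 ≤ R i) ∧ ∀ i, Tendsto (fun N => errorProb n (c N) R i) atTop (𝓝 0)

end LinDet

/-! ### The Gaussian model -/

namespace Gauss

/-- The circularly symmetric complex Gaussian law of unit variance. -/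
noncomputable def complexGaussian : Measure ℂ :=
  ((gaussianReal 0 (1 / 2)).prod (gaussianReal 0 (1 / 2))).map fun p => (⟨p.1, p.2⟩ : ℂ)

instance : IsProbabilityMeasure complexGaussian :=
  Measure.isProbabilityMeasure_map
    (Complex.measurableEquivRealProd.symm.measurable.aemeasurable :)

/-- The law of the additive noise: independent at all times and nodes. -/
noncomputable def noise (K : ℕ) (ρ : Type*) : Measure (ℕ × Node K ρ → ℂ) :=
  Measure.infinitePi fun _ => complexGaussian

variable {K : ℕ} {ρ : Type*} [Fintype ρ] {net : LayeredNetwork K ρ}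

open Classical in
/-- The received signals `Y_v[t] = ∑_{(u, v) ∈ ℰ} h_{uv} X_u[t] + Z_v[t]` for the noise
realization `Z = z`. -/
noncomputable def recv (h : net.Edge → ℂ) (z : ℕ × Node K ρ → ℂ) (t : ℕ) (X : Node K ρ → ℂ)
    (v : Node K ρ) : ℂ :=
  (∑ e : net.Edge with e.1.2 = v, h e * X e.1.1) + z (t, v)

/-- The probability `λ_i` that `D_i` decodes the message of `S_i` wrongly. -/
noncomputable def errorProb (h : net.Edge → ℂ) {N : ℕ} (c : NetCode K ρ ℂ N) (R : Fin K → ℝ)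
    (i : Fin K) : ℝ :=
  (∑ m ∈ messages N R, (noise K ρ).real {z | c.decoded (recv h z) m i ≠ m i}) /
    (messages N R).card

/-- The average power `(1 / N) 𝔼 (∑_{t < N} |X_v[t]|²)` at the node `v`. -/
noncomputable def avgPower (h : net.Edge → ℂ) {N : ℕ} (c : NetCode K ρ ℂ N) (R : Fin K → ℝ)
    (v : Node K ρ) : ℝ≥0∞ :=
  (∑ m ∈ messages N R,
    ∫⁻ z, ∑ t ∈ Finset.range N, ‖c.input (recv h z) m t v‖ₑ ^ 2 ∂(noise K ρ)) /
    ((N : ℝ≥0∞) * (messages N R).card)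

/-- In the state `h`, the sequence `c` of (measurable) codes has rates `R`, satisfies the power
constraint `1` asymptotically at all nodes, and all its error probabilities tend to zero. -/
def Reliable (h : net.Edge → ℂ) (c : (N : ℕ) → NetCode K ρ ℂ N) (R : Fin K → ℝ) : Prop :=
  (∀ N r t, Measurable ((c N).relay r t)) ∧ (∀ N i, Measurable ((c N).dec i)) ∧
  (∀ v, limsup (fun N => avgPower h (c N) R v) atTop ≤ 1) ∧
  (∀ i, 0 ≤ R i) ∧ ∀ i, Tendsto (fun N => errorProb h (c N) R i) atTop (𝓝 0)

end Gauss

/-! ### Normalized sum-capacity -/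

/-- The supremum of the sum-rates `∑ R_i` of all reliable sequences of codes. For a fixed network
state, all the codes are admitted here, so that they may depend on the whole state: this is the
sum-capacity with full network knowledge. -/
noncomputable def sumCapacity {K : ℕ} {ρ A : Type*}
    (reliable : ((N : ℕ) → NetCode K ρ A N) → (Fin K → ℝ) → Prop) : EReal :=
  sSup {x | ∃ c R, reliable c R ∧ x = ((∑ i, R i : ℝ) : EReal)}

namespace LayeredNetwork

variable {K : ℕ} {ρ : Type*} (net : LayeredNetwork K ρ)

/-- The rates `R` and the codes `c`, given as functions of the network state, use `h`-local view
only: whatever concerns a node is the same in any two states that look the same to that node. -/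
def IsLocal (h : ℕ) {σ G A : Type*} (gain : σ → net.Edge → G) (R : σ → Fin K → ℝ)
    (c : σ → (N : ℕ) → NetCode K ρ A N) : Prop :=
  ∀ s s' : σ,
    (∀ i, net.SameView h (.src i) (gain s) (gain s') →
      R s i = R s' i ∧ ∀ N, (c s N).enc i = (c s' N).enc i) ∧
    (∀ r, net.SameView h (.relay r) (gain s) (gain s') →
      ∀ N, (c s N).relay r = (c s' N).relay r) ∧
    (∀ i, net.SameView h (.dst i) (gain s) (gain s') →
      ∀ N, (c s N).dec i = (c s' N).dec i)

/-- There are strategies with `h`-local view that are reliable in every network state `s : σ` and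
whose sum-rate is at least `α C_sum - τ` in every state. -/
def AttainsFraction (h : ℕ) {σ G A : Type*} (gain : σ → net.Edge → G)
    (reliable : σ → ((N : ℕ) → NetCode K ρ A N) → (Fin K → ℝ) → Prop) (α τ : ℝ) : Prop :=
  ∃ (R : σ → Fin K → ℝ) (c : σ → (N : ℕ) → NetCode K ρ A N), net.IsLocal h gain R c ∧
    ∀ s, reliable s (c s) (R s) ∧
      (α : EReal) * sumCapacity (reliable s) ≤ ((∑ i, R s i + τ : ℝ) : EReal)

variable [Fintype ρ]

/-- Achievable normalized sum-rates, linear deterministic model. The constant `τ` is independent of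
all channel gains. The largest gain `q` is the length of the signal vectors, so that strategies may
depend on `q` besides the local view. -/
def LinDetAchievable (h : ℕ) (α : ℝ) : Prop :=
  ∃ τ : ℝ, ∀ q : ℕ, net.AttainsFraction h (fun n : LinDet.State net q => n.1) LinDet.Reliable α τ

/-- Achievable normalized sum-rates, Gaussian model. The constant `τ` is independent of the channel
gains. -/
def GaussAchievable (h : ℕ) (α : ℝ) : Prop :=
  ∃ τ : ℝ, net.AttainsFraction h (fun g : net.Edge → ℂ => g) Gauss.Reliable α τ

/-- The normalized sum-capacity with `h`-local view, linear deterministic model. -/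
noncomputable def linDetNormalizedSumCapacity (h : ℕ) : EReal :=
  sSup {x | ∃ α : ℝ, net.LinDetAchievable h α ∧ x = (α : EReal)}

/-- The normalized sum-capacity with `h`-local view, Gaussian model. -/
noncomputable def gaussNormalizedSumCapacity (h : ℕ) : EReal :=
  sSup {x | ∃ α : ℝ, net.GaussAchievable h α ∧ x = (α : EReal)}

end LayeredNetwork

/-! Somewhere in the network two flows `S_a → D_a` and `S_b → D_b` can be made to meet at a node `x`
whose received signal determines both messages, while neither source can tell whether the other one
is active. Topology (`exists_meetingFlows`). The given path starts on a route of `i` and ends off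
all of them, so it has a link from a node on such a route to a node off all of them. The latter node
lies on a route `F` of some `b ≠ i`. Follow a route `P` of `a = i` to that link, cross it, and
continue along `F` to `D_b`: this is `Q`. After the crossing, `P` and `Q` never meet again, since
otherwise the crossed link would lie on a route of `i`. Let `x` be the first node common to `F` and
`Q`. It hears one node `p` fed by `S_a` and one node `f` fed by `S_b`; `D_b` is fed through `x`
alone, and `D_a` through `x` or through a node that hears only `p`. Locality
(`AttainsFraction.two_mul_le`). Give all active links one common gain and the others gain `0`.
Removing the links that leave the other source is invisible in a source's 1-local view. After the
removal a single user can communicate and the sum-capacity is nearly the capacity `C` of one link,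
so that user must have rate at least about `αC - τ`. The same two rates are then used in the state
where both flows are active. Converse. From the signal at `x` one decodes `W_b`, reconstructs the
input of `f`, subtracts it, and obtains what `D_a` needs. Hence the two rates together are at most
about `C`, and growing gains force `2α ≤ 1`. In the deterministic model the converse is a count of
the possible signals at `x`, and capacity `q - 1` is reached by plain forwarding. In the Gaussian
model, fix the error-correction parameter `d` and the grid spacing `g`. The gain `2 · 2^k · g`
supports about `2k(1 - 2/d)` bits by grid modulation, per-hop rounding and a Gilbert–Varshamov code
against rare large noise. The converse `2k + O(1)` compares all shifted noise laws with one wider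
Gaussian law, under which disjoint decoding sets have total mass at most `1`
(`sum_measure_decoded_le`). Then `k → ∞`, and afterwards `d → ∞`. -/

namespace LayeredNetwork

variable {K : ℕ} {ρ : Type*} (net : LayeredNetwork K ρ)

/-! ### Routes as functions of the layer -/

/-- The layer of a node. -/
def layer : Node K ρ → ℕ
  | .src _ => 1
  | .relay r => net.relayLayer r
  | .dst _ => net.L

variable {net}

lemma layer_of_adj {u v : Node K ρ} (h : net.Adj u v) : net.layer v = net.layer u + 1 := by
  have := net.adj_layer u v h
  cases u <;> cases v <;> exact this

lemma one_le_layer (v : Node K ρ) : 1 ≤ net.layer v := by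
  cases v with
  | src => exact le_rfl
  | relay r => exact (net.relayLayer_gt r).le
  | dst => exact one_le_two.trans net.two_le

lemma not_adj_src {u : Node K ρ} {c : Fin K} : ¬ net.Adj u (.src c) := by
  intro h
  have h1 := layer_of_adj h
  have h2 := one_le_layer (net := net) u
  change 1 = _ at h1
  omega

variable (net) in
/-- `r l` is the node in layer `l` of a walk from `S_i` to `D_j`, for `1 ≤ l ≤ L`. -/
structure IsPath (i j : Fin K) (r : ℕ → Node K ρ) : Prop where
  start : r 1 = .src i
  finish : r net.L = .dst j
  adj : ∀ l, 1 ≤ l → l < net.L → net.Adj (r l) (r (l + 1))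

lemma IsPath.layer {i j : Fin K} {r : ℕ → Node K ρ} (h : net.IsPath i j r) {l : ℕ}
    (h1 : 1 ≤ l) (h2 : l ≤ net.L) : net.layer (r l) = l := by
  induction l, h1 using Nat.le_induction with
  | base => rw [h.start]; rfl
  | succ l hl ih => rw [layer_of_adj (h.adj l hl (by omega)), ih (by omega)]

/-- Every link raises the layer by exactly one, so the entry of index `k` lies in layer `k + 1` and
the list has length `L`. Indexing by layers makes splicing and comparing routes pointwise. -/
lemma IsRoute.exists_isPath {i j : Fin K} {p : List (Node K ρ)}
    (hp : net.IsRoute (.src i) (.dst j) p) :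
    ∃ r, net.IsPath i j r ∧ (∀ v ∈ p, r (net.layer v) = v) ∧
      ∀ l, 1 ≤ l → l ≤ net.L → r l ∈ p := by
  obtain ⟨hc, hh, hl⟩ := hp
  have hne : p ≠ [] := by rintro rfl; simp at hh
  have hpos : 0 < p.length := List.length_pos_iff.2 hne
  have hlay : ∀ (k : ℕ) (hk : k < p.length), net.layer p[k] = k + 1 := by
    intro k
    induction k with
    | zero =>
      intro hk
      have : p[0] = .src i := by
        rw [List.head?_eq_getElem?, List.getElem?_eq_getElem hk] at hh
        exact Option.some.inj hh
      rw [this]; rfl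
    | succ k ih =>
      intro hk
      rw [layer_of_adj ((List.isChain_iff_getElem.1 hc) k hk), ih (by omega)]
  have hlast : p[p.length - 1] = .dst j := by
    rw [List.getLast?_eq_getElem?, List.getElem?_eq_getElem (by omega)] at hl
    exact Option.some.inj hl
  have hlen : p.length = net.L := by
    have := hlay (p.length - 1) (by omega)
    rw [hlast] at this
    simp only [LayeredNetwork.layer] at this
    omega
  have hr : ∀ l (h1 : 1 ≤ l) (h2 : l ≤ net.L),
      (p[l - 1]?).getD (.src i) = p[l - 1] := by
    intro l h1 h2
    rw [List.getElem?_eq_getElem (by omega)]; rfl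
  -- The default value is used only beyond layer `L`.
  refine ⟨fun l => (p[l - 1]?).getD (.src i), ⟨?_, ?_, ?_⟩, ?_, ?_⟩
  · rw [List.head?_eq_getElem?] at hh
    simp [hh]
  · have h2 := net.two_le
    simp only [hr net.L (by omega) le_rfl]
    simp only [← hlen, hlast]
  · intro l h1 h2
    simp only [hr l h1 h2.le, hr (l + 1) (by omega) h2]
    have := (List.isChain_iff_getElem.1 hc) (l - 1) (by omega)
    simpa [Nat.sub_add_cancel h1] using this
  · intro v hv
    obtain ⟨k, hk, rfl⟩ := List.mem_iff_getElem.1 hv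
    simp only [hlay k hk]
    simp [hk]
  · intro l h1 h2
    simp only [hr l h1 h2]
    exact List.getElem_mem _

/-! ### Local views of the sources -/

/-- The route-adjacency graph is bipartite, so no other source is within one hop of `S_c`. Every
link in the view therefore lies on a route starting at `S_c`, and no link enters a source, so a link
leaving a source can only be the first of its route. -/
lemma eq_of_mem_sourceView_one {c : Fin K} {e : net.Edge} (he : e ∈ net.sourceView 1 c)
    {d : Fin K} (hd : e.1.1 = .src d) : d = c := by
  obtain ⟨j, k, hj, -, p, ⟨hc, hh, -⟩, hi⟩ := he
  have hjc : j = c := by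
    by_contra hne
    have hadj : ¬ net.routeAdjacencyGraph.Adj (Sum.inl c) (Sum.inl j) := by
      simp [routeAdjacencyGraph]
    have h1 : net.routeAdjacencyGraph.edist (Sum.inl c) (Sum.inl j) ≠ ⊤ := by
      intro h
      rw [h] at hj
      exact absurd hj (by decide)
    obtain ⟨w, hw⟩ := SimpleGraph.exists_walk_of_edist_ne_top h1
    rw [← hw] at hj
    have hj' : w.length ≤ 1 := by exact_mod_cast hj
    cases w with
    | nil => exact hne rfl
    | cons h q =>
      cases q with
      | nil => exact hadj h
      | cons _ _ => simp at hj'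
  subst hjc
  obtain ⟨s, t, rfl⟩ := hi
  rcases List.eq_nil_or_concat s with rfl | ⟨s', z, rfl⟩
  · rw [hd] at hh
    simpa using hh
  · exfalso
    have : net.Adj z e.1.1 := by
      simp only [List.concat_eq_append, List.append_assoc, List.cons_append, List.nil_append] at hc
      have := hc.right_of_append
      exact (List.isChain_cons_cons.1 this).1
    rw [hd] at this
    exact not_adj_src this

/-! ### Two flows that meet -/

/-- Active links that carry a flow from `S_a` to `D_a` and a flow from `S_b` to `D_b`, such that
the node `x` hears exactly one node `p` fed by `S_a` alone and one node `f` fed by `S_b` alone,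
`D_b` is fed through `x` alone, and `D_a` is fed through `κ` alone, where `κ` is `x` or hears
exactly `p`. -/
structure MeetingFlows (net : LayeredNetwork K ρ) (a b : Fin K) where
  Active : Node K ρ → Node K ρ → Prop
  adj : ∀ u v, Active u v → net.Adj u v
  active_src : ∀ c v, Active (.src c) v → c = a ∨ c = b
  (p f x κ : Node K ρ)
  -- `SA` and `SB` lie upstream and are closed under active predecessors, so inputs inside them
  -- depend on one message only. `TA` and `TB` lie downstream, contain no source, and can be entered
  -- only through `κ` and `x`.
  (SA SB TA TB : Set (Node K ρ))
  SA_closed : ∀ u v, Active u v → v ∈ SA → u ∈ SA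
  SA_src : ∀ c, .src c ∈ SA → c = a
  p_mem : p ∈ SA
  x_notMem_SA : x ∉ SA
  κ_notMem_SA : κ ∉ SA
  SB_closed : ∀ u v, Active u v → v ∈ SB → u ∈ SB
  SB_src : ∀ c, .src c ∈ SB → c = b
  f_mem : f ∈ SB
  x_notMem_SB : x ∉ SB
  κ_notMem_SB : κ ∉ SB
  TA_closed : ∀ u v, Active u v → v ∈ TA → v ≠ κ → u ∈ TA
  TA_src : ∀ c, .src c ∉ TA
  dst_mem_TA : .dst a ∈ TA
  TB_closed : ∀ u v, Active u v → v ∈ TB → v ≠ x → u ∈ TB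
  TB_src : ∀ c, .src c ∉ TB
  dst_mem_TB : .dst b ∈ TB
  p_ne_f : p ≠ f
  active_x : ∀ u, Active u x ↔ u = p ∨ u = f
  active_κ : κ ≠ x → ∀ u, Active u κ ↔ u = p
  route_a : ∃ r, net.IsPath a a r ∧ ∀ l, 1 ≤ l → l < net.L → Active (r l) (r (l + 1))
  route_b : ∃ r, net.IsPath b b r ∧ ∀ l, 1 ≤ l → l < net.L → Active (r l) (r (l + 1))

/-- Two routes `Q` (from `S_a` to `D_b`) and `P` (from `S_a` to `D_a`) that agree up to layer `m`
and differ at all later layers, and a route `F` of `b` that meets `Q` at layer `m + 1`. -/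
lemma nonempty_meetingFlows_of_paths {a b : Fin K} (hab : a ≠ b) {Q P F : ℕ → Node K ρ} {m : ℕ}
    (hm : 1 ≤ m) (hmL : m < net.L) (hQ : net.IsPath a b Q) (hP : net.IsPath a a P)
    (hF : net.IsPath b b F) (hle : ∀ l, l ≤ m → P l = Q l)
    (hgt : ∀ l, m < l → l ≤ net.L → P l ≠ Q l) (hmeet : F (m + 1) = Q (m + 1)) :
    Nonempty (net.MeetingFlows a b) := by
  classical
  have hex : ∃ l, 1 ≤ l ∧ F l = Q l := ⟨m + 1, by omega, hmeet⟩
  -- The first meeting layer of `F` and `Q` is used instead of `m + 1`: this keeps the two flows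
  -- disjoint upstream of `x`.
  obtain ⟨l0, ⟨hl0, hFQ⟩, hmin⟩ :
      ∃ l, (1 ≤ l ∧ F l = Q l) ∧ ∀ k, 1 ≤ k → k < l → F k ≠ Q k :=
    ⟨Nat.find hex, Nat.find_spec hex, fun k hk hlt h => Nat.find_min hex hlt ⟨hk, h⟩⟩
  have hl0m : l0 ≤ m + 1 := by
    by_contra h
    exact hmin (m + 1) (by omega) (by omega) hmeet
  have hl02 : 2 ≤ l0 := by
    rcases Nat.lt_or_ge l0 2 with h | h
    · exfalso
      obtain rfl : l0 = 1 := by omega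
      rw [hF.start, hQ.start] at hFQ
      exact hab (Node.src.inj hFQ).symm
    · exact h
  -- `F` is active only up to its first meeting with `Q`; from there the flow of `b` continues along
  -- `Q`, so no second copy of it enters downstream.
  let Act : Node K ρ → Node K ρ → Prop := fun u v => ∃ l, 1 ≤ l ∧ l < net.L ∧
    ((u = Q l ∧ v = Q (l + 1)) ∨ (u = P l ∧ v = P (l + 1)) ∨
      (l < l0 ∧ u = F l ∧ v = F (l + 1)))
  have lQ := fun {l} => hQ.layer (l := l)
  have lP := fun {l} => hP.layer (l := l)
  have lF := fun {l} => hF.layer (l := l)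
  -- Layers identify the active predecessors: a node of `Q` hears its predecessor on `Q`, and up to
  -- layer `l0` possibly that on `F`. A link of `P` can enter `Q` only while the two still agree.
  have inQ : ∀ {u l}, 1 ≤ l → l ≤ net.L → Act u (Q l) → (2 ≤ l ∧ u = Q (l - 1)) ∨
      (l ≤ l0 ∧ 2 ≤ l ∧ F l = Q l ∧ u = F (l - 1)) := by
    rintro u l h1 h2 ⟨k, hk1, hk2, ⟨rfl, h⟩ | ⟨rfl, h⟩ | ⟨hk0, rfl, h⟩⟩
    · have : l = k + 1 := by rw [← lQ h1 h2, h, lQ (by omega) (by omega)]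
      subst this
      exact Or.inl ⟨by omega, rfl⟩
    · have : l = k + 1 := by rw [← lQ h1 h2, h, lP (by omega) (by omega)]
      subst this
      left
      have : k + 1 ≤ m := by
        by_contra hlt
        exact hgt (k + 1) (by omega) h2 h.symm
      exact ⟨by omega, hle _ (by omega)⟩
    · have : l = k + 1 := by rw [← lQ h1 h2, h, lF (by omega) (by omega)]
      subst this
      exact Or.inr ⟨by omega, by omega, h.symm, rfl⟩
  have inP : ∀ {u l}, 1 ≤ l → l ≤ net.L → Act u (P l) → (2 ≤ l ∧ u = P (l - 1)) ∨
      (l ≤ l0 ∧ 2 ≤ l ∧ F l = P l ∧ u = F (l - 1)) := by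
    rintro u l h1 h2 ⟨k, hk1, hk2, ⟨rfl, h⟩ | ⟨rfl, h⟩ | ⟨hk0, rfl, h⟩⟩
    · have : l = k + 1 := by rw [← lP h1 h2, h, lQ (by omega) (by omega)]
      subst this
      left
      have : k + 1 ≤ m := by
        by_contra hlt
        exact hgt (k + 1) (by omega) h2 h
      exact ⟨by omega, (hle _ (by omega)).symm⟩
    · have : l = k + 1 := by rw [← lP h1 h2, h, lP (by omega) (by omega)]
      subst this
      exact Or.inl ⟨by omega, rfl⟩
    · have : l = k + 1 := by rw [← lP h1 h2, h, lF (by omega) (by omega)]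
      subst this
      exact Or.inr ⟨by omega, by omega, h.symm, rfl⟩
  have inF : ∀ {u l}, 1 ≤ l → l < l0 → Act u (F l) → 2 ≤ l ∧ u = F (l - 1) := by
    rintro u l h1 h2 ⟨k, hk1, hk2, ⟨rfl, h⟩ | ⟨rfl, h⟩ | ⟨hk0, rfl, h⟩⟩
    · have : l = k + 1 := by rw [← lF h1 (by omega), h, lQ (by omega) (by omega)]
      subst this
      exact absurd h (hmin _ (by omega) h2)
    · have : l = k + 1 := by rw [← lF h1 (by omega), h, lP (by omega) (by omega)]
      subst this
      rw [hle _ (by omega)] at h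
      exact absurd h (hmin _ (by omega) h2)
    · have : l = k + 1 := by rw [← lF h1 (by omega), h, lF (by omega) (by omega)]
      subst this
      exact ⟨by omega, rfl⟩
  have srcLayer : ∀ {R : ℕ → Node K ρ} {i j : Fin K}, net.IsPath i j R → ∀ {l c}, 1 ≤ l →
      l ≤ net.L → Node.src c = R l → l = 1 ∧ c = i := by
    intro R i j hR l c h1 h2 h
    have : l = 1 := by rw [← hR.layer h1 h2, ← h]; rfl
    subst this
    rw [hR.start] at h
    exact ⟨rfl, Node.src.inj h⟩
  -- If `l0 ≤ m`, then `P` and `Q` still agree and `κ = x`. If `l0 = m + 1`, then `P` has just left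
  -- `Q`, and `κ ≠ x` hears only the common predecessor `p`.
  refine ⟨{
    Active := Act
    p := Q (l0 - 1), f := F (l0 - 1), x := Q l0, κ := P l0
    SA := {v | ∃ l, 1 ≤ l ∧ l < l0 ∧ v = Q l}
    SB := {v | ∃ l, 1 ≤ l ∧ l < l0 ∧ v = F l}
    TA := {v | ∃ l, l0 ≤ l ∧ l ≤ net.L ∧ v = P l}
    TB := {v | ∃ l, l0 ≤ l ∧ l ≤ net.L ∧ v = Q l}
    adj := ?_, active_src := ?_, SA_closed := ?_, SA_src := ?_
    p_mem := ⟨l0 - 1, by omega, by omega, rfl⟩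
    x_notMem_SA := ?_, κ_notMem_SA := ?_, SB_closed := ?_, SB_src := ?_
    f_mem := ⟨l0 - 1, by omega, by omega, rfl⟩
    x_notMem_SB := ?_, κ_notMem_SB := ?_, TA_closed := ?_, TA_src := ?_
    dst_mem_TA := ⟨net.L, by omega, le_rfl, hP.finish.symm⟩
    TB_closed := ?_, TB_src := ?_
    dst_mem_TB := ⟨net.L, by omega, le_rfl, hQ.finish.symm⟩
    p_ne_f := fun h => hmin (l0 - 1) (by omega) (by omega) h.symm
    active_x := ?_, active_κ := ?_
    route_a := ⟨P, hP, fun l h1 h2 => ⟨l, h1, h2, Or.inr (Or.inl ⟨rfl, rfl⟩)⟩⟩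
    route_b := ?_ }⟩
  · rintro u v ⟨l, h1, h2, ⟨rfl, rfl⟩ | ⟨rfl, rfl⟩ | ⟨-, rfl, rfl⟩⟩
    exacts [hQ.adj l h1 h2, hP.adj l h1 h2, hF.adj l h1 h2]
  · rintro c v ⟨l, h1, h2, ⟨h, -⟩ | ⟨h, -⟩ | ⟨-, h, -⟩⟩
    exacts [Or.inl (srcLayer hQ h1 h2.le h).2, Or.inl (srcLayer hP h1 h2.le h).2,
      Or.inr (srcLayer hF h1 h2.le h).2]
  · rintro u v huv ⟨l, h1, h2, rfl⟩
    rcases inQ h1 (by omega) huv with ⟨h3, rfl⟩ | ⟨-, -, h3, -⟩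
    · exact ⟨l - 1, by omega, by omega, rfl⟩
    · exact absurd h3 (hmin l h1 h2)
  · rintro c ⟨l, h1, h2, h⟩
    exact (srcLayer hQ h1 (by omega) h).2
  · rintro ⟨l, h1, h2, h⟩
    have := lQ hl0 (by omega)
    rw [h, lQ h1 (by omega)] at this
    omega
  · rintro ⟨l, h1, h2, h⟩
    have := lP hl0 (by omega)
    rw [h, lQ h1 (by omega)] at this
    omega
  · rintro u v huv ⟨l, h1, h2, rfl⟩
    obtain ⟨h3, rfl⟩ := inF h1 h2 huv
    exact ⟨l - 1, by omega, by omega, rfl⟩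
  · rintro c ⟨l, h1, h2, h⟩
    exact (srcLayer hF h1 (by omega) h).2
  · rintro ⟨l, h1, h2, h⟩
    have := lQ hl0 (by omega)
    rw [h, lF h1 (by omega)] at this
    omega
  · rintro ⟨l, h1, h2, h⟩
    have := lP hl0 (by omega)
    rw [h, lF h1 (by omega)] at this
    omega
  · rintro u v huv ⟨l, h1, h2, rfl⟩ hne
    have hl : l ≠ l0 := by rintro rfl; exact hne rfl
    rcases inP (by omega) h2 huv with ⟨h3, rfl⟩ | ⟨h3, -⟩
    · exact ⟨l - 1, by omega, by omega, rfl⟩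
    · omega
  · rintro c ⟨l, h1, h2, h⟩
    have := (srcLayer hP (by omega) h2 h).1
    omega
  · rintro u v huv ⟨l, h1, h2, rfl⟩ hne
    have hl : l ≠ l0 := by rintro rfl; exact hne rfl
    rcases inQ (by omega) h2 huv with ⟨h3, rfl⟩ | ⟨h3, -⟩
    · exact ⟨l - 1, by omega, by omega, rfl⟩
    · omega
  · rintro c ⟨l, h1, h2, h⟩
    have := (srcLayer hQ (by omega) h2 h).1
    omega
  · intro u
    constructor
    · intro hu
      rcases inQ (by omega) (by omega) hu with ⟨-, h⟩ | ⟨-, -, -, h⟩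
      exacts [Or.inl h, Or.inr h]
    · have h1 : l0 - 1 + 1 = l0 := by omega
      rintro (rfl | rfl)
      · exact ⟨l0 - 1, by omega, by omega, Or.inl ⟨rfl, by rw [h1]⟩⟩
      · exact ⟨l0 - 1, by omega, by omega, Or.inr (Or.inr ⟨by omega, rfl, by rw [h1, hFQ]⟩)⟩
  · intro hne u
    have h1 : l0 - 1 + 1 = l0 := by omega
    have h2 : P (l0 - 1) = Q (l0 - 1) := hle _ (by omega)
    constructor
    · intro hu
      rcases inP (by omega) (by omega) hu with ⟨-, h⟩ | ⟨-, -, h, -⟩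
      · rw [h, h2]
      · exact absurd (h.symm.trans hFQ) hne
    · rintro rfl
      exact ⟨l0 - 1, by omega, by omega, Or.inr (Or.inl ⟨h2.symm, by rw [h1]⟩)⟩
  · refine ⟨fun l => if l < l0 then F l else Q l, ⟨?_, ?_, ?_⟩, ?_⟩
    · simp only [show 1 < l0 by omega, if_true, hF.start]
    · simp only [show ¬ net.L < l0 by omega, if_false, hQ.finish]
    all_goals
      intro l h1 h2
      rcases lt_trichotomy (l + 1) l0 with h | h | h
      · simp only [show l < l0 by omega, h, if_true]
        first
        | exact hF.adj l h1 h2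
        | exact ⟨l, h1, h2, Or.inr (Or.inr ⟨by omega, rfl, rfl⟩)⟩
      · have h3 : Q (l + 1) = F (l + 1) := by rw [h, hFQ]
        simp only [show l < l0 by omega, show ¬ l + 1 < l0 by omega, if_true, if_false, h3]
        first
        | exact hF.adj l h1 h2
        | exact ⟨l, h1, h2, Or.inr (Or.inr ⟨by omega, rfl, rfl⟩)⟩
      · simp only [show ¬ l < l0 by omega, show ¬ l + 1 < l0 by omega, if_false]
        first
        | exact hQ.adj l h1 h2
        | exact ⟨l, h1, h2, Or.inl ⟨rfl, rfl⟩⟩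

/-- A path that follows `r` up to layer `m` and `s` from layer `m + 1` on. -/
lemma IsPath.splice {i j k l : Fin K} {r s : ℕ → Node K ρ} (hr : net.IsPath i j r)
    (hs : net.IsPath k l s) {m : ℕ} (hm : 1 ≤ m) (hmL : m < net.L)
    (hadj : net.Adj (r m) (s (m + 1))) :
    net.IsPath i l (fun n => if n ≤ m then r n else s n) := by
  refine ⟨by simp only [hm, if_true, hr.start], by simp [hmL.not_ge, hs.finish], ?_⟩
  intro n h1 h2
  rcases lt_trichotomy n m with h | rfl | h
  · simpa only [h.le, Nat.succ_le_of_lt h, if_true] using hr.adj n h1 h2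
  · simpa using hadj
  · simpa only [h.not_ge, show ¬ n + 1 ≤ m by omega, if_false] using hs.adj n h1 h2

/-- The user `b` is the owner of the first node found off the routes of `i`, which need not be `j`;
the new path therefore leads to `D_b`. -/
lemma exists_meetingFlows {i j : Fin K} (hij : i ≠ j)
    (hpath : ∃ p, net.IsRoute (.src i) (.dst j) p ∧ ∀ v ∈ p, ∃ k, net.OnRoute k k v) :
    ∃ b, i ≠ b ∧ Nonempty (net.MeetingFlows i b) := by
  obtain ⟨p, hp, hon⟩ := hpath
  obtain ⟨r, hr, -, hrp⟩ := hp.exists_isPath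
  let On : Fin K → ℕ → Prop := fun k l => ∃ s, net.IsPath k k s ∧ s l = r l
  have hon' : ∀ l, 1 ≤ l → l ≤ net.L → ∃ k, On k l := by
    intro l h1 h2
    obtain ⟨k, q, hq, hv⟩ := hon _ (hrp l h1 h2)
    obtain ⟨s, hs, hsv, -⟩ := hq.exists_isPath
    have := hsv _ hv
    rw [hr.layer h1 h2] at this
    exact ⟨k, s, hs, this⟩
  have hL := net.two_le
  have h1 : On i 1 := by
    obtain ⟨k, s, hs, h⟩ := hon' 1 le_rfl (by omega)
    have hk := h
    rw [hs.start, hr.start] at hk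
    obtain rfl := Node.src.inj hk
    exact ⟨s, hs, h⟩
  have h2 : ¬ On i net.L := by
    rintro ⟨s, hs, h⟩
    rw [hs.finish, hr.finish] at h
    exact hij (Node.dst.inj h)
  -- The source is on a route of `i` and `D_j` is not, so being on such a route is lost at some
  -- layer.
  obtain ⟨m, hm1, hmL, hm, hm'⟩ : ∃ m, 1 ≤ m ∧ m < net.L ∧ On i m ∧ ¬ On i (m + 1) := by
    by_contra hcon
    push Not at hcon
    refine h2 (Nat.le_induction (m := 1) (P := fun l _ => l ≤ net.L → On i l) (fun _ => h1)
      (fun l hl ih hlL => ?_) net.L (by omega) le_rfl)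
    exact hcon l hl (by omega) (ih (by omega))
  obtain ⟨P, hP, hPm⟩ := hm
  obtain ⟨b, F, hF, hFm⟩ := hon' (m + 1) (by omega) hmL
  have hib : i ≠ b := by
    rintro rfl
    exact hm' ⟨F, hF, hFm⟩
  have hadj : net.Adj (P m) (F (m + 1)) := by
    rw [hPm, hFm]; exact hr.adj m hm1 hmL
  refine ⟨b, hib, nonempty_meetingFlows_of_paths hib hm1 hmL (hP.splice hF hm1 hmL hadj) hP hF
    (fun l hl => by simp [hl]) ?_ (by simp)⟩
  intro l hl hlL heq
  simp only [hl.not_ge, if_false] at heq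
  have hlt : l < net.L := by
    refine lt_of_le_of_ne hlL ?_
    rintro rfl
    rw [hP.finish, hF.finish] at heq
    exact hib (Node.dst.inj heq)
  -- If `P` and `F` met again at layer `l`, then `P` up to `m`, `F` from `m + 1` to `l`, and `P`
  -- afterwards would be a route of `i` through the node of layer `m + 1`.
  refine hm' ⟨_, (hP.splice hF hm1 hmL hadj).splice hP (m := l) (by omega) hlt ?_, ?_⟩
  · simpa only [hl.not_ge, if_false, ← heq] using hP.adj l (by omega) hlt
  · simpa [Nat.succ_le_of_lt hl] using hFm

end LayeredNetwork

/-! ### Causality: which signals a run of a code depends on -/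

namespace NetCode

variable {K : ℕ} {ρ : Type*} {A : Type*} {N : ℕ} [Zero A] (c : NetCode K ρ A N)

lemma received_apply (recv : ℕ → (Node K ρ → A) → Node K ρ → A) (m : Fin K → ℕ) {t : ℕ}
    (v : Node K ρ) (k : Fin t) : c.received recv m t v k = recv k (c.input recv m k) v := by
  induction t with
  | zero => exact k.elim0
  | succ t ih =>
    rw [received]
    refine Fin.lastCases ?_ (fun k => ?_) k
    · rw [Fin.snoc_last]; rfl
    · rw [Fin.snoc_castSucc, ih]; rfl

/-- Two runs of a code agree on a set `S` of nodes whose received signals agree as soon as the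
inputs of the nodes in `S` do. -/
lemma received_congr {recv recv' : ℕ → (Node K ρ → A) → Node K ρ → A} {m m' : Fin K → ℕ}
    (S : Set (Node K ρ)) {T : ℕ} (hm : ∀ i, .src i ∈ S → m i = m' i)
    (H : ∀ t < T, (∀ u ∈ S, c.input recv m t u = c.input recv' m' t u) →
      ∀ v ∈ S, recv t (c.input recv m t) v = recv' t (c.input recv' m' t) v) :
    ∀ t ≤ T, ∀ v ∈ S, c.received recv m t v = c.received recv' m' t v ∧
      c.input recv m t v = c.input recv' m' t v := by
  have key : ∀ t, (∀ v ∈ S, c.received recv m t v = c.received recv' m' t v) →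
      ∀ v ∈ S, c.input recv m t v = c.input recv' m' t v := by
    intro t ht v hv
    rw [input, input, ht v hv]
    cases v with
    | src i => simp only [send, hm i hv]
    | relay r => rfl
    | dst i => rfl
  intro t
  induction t with
  | zero =>
    intro _ v hv
    have : ∀ v ∈ S, c.received recv m 0 v = c.received recv' m' 0 v := fun v _ => rfl
    exact ⟨rfl, key 0 this v hv⟩
  | succ t ih =>
    intro ht v hv
    have h1 := ih (by omega)
    have : ∀ v ∈ S, c.received recv m (t + 1) v = c.received recv' m' (t + 1) v := by
      intro v hv
      rw [received, received, (h1 v hv).1]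
      exact congrArg _ (H t (by omega) (fun u hu => (h1 u hu).2) v hv)
    exact ⟨this v hv, key _ this v hv⟩

/-- If no node hears the source `S_i`, then the message of `S_i` affects no received signal. -/
lemma decoded_update {recv : ℕ → (Node K ρ → A) → Node K ρ → A} {i : Fin K}
    (hrecv : ∀ t X X' v, (∀ u, u ≠ .src i → X u = X' u) → recv t X v = recv t X' v)
    (m : Fin K → ℕ) (k : ℕ) (j : Fin K) :
    c.decoded recv (Function.update m i k) j = c.decoded recv m j := by
  have h := c.received_congr (recv := recv) (recv' := recv) (m := Function.update m i k) (m' := m)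
    {u | u ≠ .src i} (T := N) ?_ ?_ N le_rfl (.dst j) (by simp)
  · rw [decoded, decoded, h.1]
  · intro i' hi'
    rw [Function.update_of_ne]
    rintro rfl
    exact hi' rfl
  · intro t _ hu v _
    exact hrecv t _ _ v hu

end NetCode

/-! ### Messages -/

section Messages

variable {K : ℕ}

lemma mem_messages {N : ℕ} {R : Fin K → ℝ} {m : Fin K → ℕ} :
    m ∈ messages N R ↔ ∀ i, m i < ⌊(2 : ℝ) ^ (N * R i)⌋₊ := by
  simp [messages]

lemma one_le_floor_two_rpow {N : ℕ} {x : ℝ} (hx : 0 ≤ x) : 1 ≤ ⌊(2 : ℝ) ^ (N * x)⌋₊ :=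
  Nat.le_floor (by
    rw [Nat.cast_one]
    exact Real.one_le_rpow one_le_two (by positivity))

lemma messages_card_pos {N : ℕ} {R : Fin K → ℝ} (hR : ∀ i, 0 ≤ R i) :
    0 < (messages N R).card := by
  rw [messages, Fintype.card_piFinset]
  refine Finset.prod_pos fun i _ => ?_
  rw [Finset.card_range]
  exact one_le_floor_two_rpow (hR i)

lemma messages_apply_of_rate_zero {N : ℕ} {R : Fin K → ℝ} {m : Fin K → ℕ} (hm : m ∈ messages N R)
    {i : Fin K} (hi : R i = 0) : m i = 0 := by
  have := mem_messages.1 hm i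
  simpa [hi] using this

lemma messages_card_of_two {N : ℕ} {R : Fin K → ℝ} {a b : Fin K} (hab : a ≠ b)
    (h : ∀ i, i ≠ a → i ≠ b → R i = 0) :
    (messages N R).card = ⌊(2 : ℝ) ^ (N * R a)⌋₊ * ⌊(2 : ℝ) ^ (N * R b)⌋₊ := by
  rw [messages, Fintype.card_piFinset]
  simp only [Finset.card_range]
  rw [← Finset.mul_prod_erase _ _ (Finset.mem_univ a),
    ← Finset.mul_prod_erase _ _ (Finset.mem_erase.2 ⟨hab.symm, Finset.mem_univ b⟩),
    Finset.prod_eq_one, mul_one]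
  intro i hi
  simp only [Finset.mem_erase, Finset.mem_univ, and_true] at hi
  simp [h i hi.2 hi.1]

lemma messages_ext {N : ℕ} {R : Fin K → ℝ} {a b : Fin K}
    (h : ∀ i, i ≠ a → i ≠ b → R i = 0) {m m' : Fin K → ℕ} (hm : m ∈ messages N R)
    (hm' : m' ∈ messages N R) (ha : m a = m' a) (hb : m b = m' b) : m = m' := by
  funext i
  by_cases hia : i = a
  · rw [hia, ha]
  by_cases hib : i = b
  · rw [hib, hb]
  rw [messages_apply_of_rate_zero hm (h i hia hib), messages_apply_of_rate_zero hm' (h i hia hib)]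

/-- The cyclic shift of the `i`-th message permutes the message tuples and, with at least two
messages, moves each of them. Summing the hypothesis over all pairs of a tuple and its shift counts
every `e m` twice. -/
lemma messages_card_le_two_mul_sum {N : ℕ} {R : Fin K → ℝ} {i : Fin K}
    (hM : 2 ≤ ⌊(2 : ℝ) ^ (N * R i)⌋₊) (e : (Fin K → ℕ) → ℝ)
    (he : ∀ m k, k ≠ m i → 1 ≤ e m + e (Function.update m i k)) :
    ((messages N R).card : ℝ) ≤ 2 * ∑ m ∈ messages N R, e m := by
  set M := ⌊(2 : ℝ) ^ (N * R i)⌋₊ with hMdef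
  let σ : (Fin K → ℕ) → Fin K → ℕ := fun m => Function.update m i ((m i + 1) % M)
  have hmaps : Set.MapsTo σ (messages N R) (messages N R) := by
    intro m hm
    rw [Finset.mem_coe, mem_messages] at hm ⊢
    intro j
    by_cases hj : j = i
    · subst hj
      simpa [σ] using Nat.mod_lt _ (by omega)
    · simpa [σ, hj] using hm j
  have hmod : ∀ x y, x < M → y < M → (x + 1) % M = (y + 1) % M → x = y := by
    intro x y hx hy h
    have := Nat.ModEq.add_right_cancel' 1 (show x + 1 ≡ y + 1 [MOD M] from h)
    rwa [Nat.ModEq, Nat.mod_eq_of_lt hx, Nat.mod_eq_of_lt hy] at this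
  have hinj : Set.InjOn σ (messages N R) := by
    intro m hm m' hm' h
    rw [Finset.mem_coe, mem_messages] at hm hm'
    funext j
    have hj := congrFun h j
    by_cases hji : j = i
    · subst hji
      simp only [σ, Function.update_self] at hj
      exact hmod _ _ (hm j) (hm' j) hj
    · simpa [σ, hji] using hj
  have hsurj : Set.SurjOn σ (messages N R) (messages N R) :=
    Finset.surjOn_of_injOn_of_card_le σ hmaps hinj le_rfl
  have hsum : ∑ m ∈ messages N R, e (σ m) = ∑ m ∈ messages N R, e m :=
    Finset.sum_nbij σ hmaps hinj hsurj (fun _ _ => rfl)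
  calc ((messages N R).card : ℝ) = ∑ m ∈ messages N R, (1 : ℝ) := by simp
    _ ≤ ∑ m ∈ messages N R, (e m + e (σ m)) := by
      refine Finset.sum_le_sum fun m hm => he m _ ?_
      intro h
      have hlt := mem_messages.1 hm i
      rw [← hMdef] at hlt
      rcases Nat.lt_or_ge (m i + 1) M with h1 | h1
      · rw [Nat.mod_eq_of_lt h1] at h; omega
      · have : m i + 1 = M := by omega
        rw [this, Nat.mod_self] at h; omega
    _ = 2 * ∑ m ∈ messages N R, e m := by rw [Finset.sum_add_distrib, hsum, two_mul]

/-- At a positive rate there are at least two messages for all large `N`, so the error could not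
tend to `0`. -/
lemma rate_eq_zero {x : ℝ} (hx : 0 ≤ x) {err : ℕ → ℝ} (herr : Tendsto err atTop (𝓝 0))
    (h : ∀ N : ℕ, 2 ≤ ⌊(2 : ℝ) ^ (N * x)⌋₊ → 1 / 2 ≤ err N) : x = 0 := by
  by_contra hne
  have hpos : 0 < x := lt_of_le_of_ne hx (Ne.symm hne)
  have h1 : ∀ᶠ N in atTop, err N < 1 / 2 := herr.eventually (gt_mem_nhds (by norm_num))
  obtain ⟨N, hN1, hN2⟩ := (h1.and (eventually_ge_atTop ⌈1 / x⌉₊)).exists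
  refine absurd (h N (Nat.le_floor ?_)) hN1.not_ge
  have h2 : (1 : ℝ) ≤ N * x := by
    have := Nat.le_of_ceil_le hN2
    rwa [div_le_iff₀ hpos] at this
  calc ((2 : ℕ) : ℝ) = 2 ^ (1 : ℝ) := by simp
    _ ≤ 2 ^ (N * x) := Real.rpow_le_rpow_of_exponent_le one_le_two h2

/-- If `M` messages at sum-rate `r` are at most `c` times `2 ^ (N u)` for all large `N`, then
`r ≤ u`. -/
lemma rate_add_le {x y u c : ℝ} (hx : 0 ≤ x) (hy : 0 ≤ y)
    (h : ∀ᶠ N : ℕ in atTop, ((⌊(2 : ℝ) ^ (N * x)⌋₊ * ⌊(2 : ℝ) ^ (N * y)⌋₊ : ℕ) : ℝ) ≤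
      c * 2 ^ (N * u)) : x + y ≤ u := by
  by_contra hlt
  push Not at hlt
  -- Rounding down loses at most a factor `2` per user, which the exponential comparison absorbs in
  -- the constant `4 * c`.
  have hhalf : ∀ (N : ℕ) {z : ℝ}, 0 ≤ z → (2 : ℝ) ^ (N * z) / 2 ≤ ⌊(2 : ℝ) ^ (N * z)⌋₊ := by
    intro N z hz
    have h1 : (1 : ℝ) ≤ ⌊(2 : ℝ) ^ (N * z)⌋₊ := by exact_mod_cast one_le_floor_two_rpow hz
    have h2 := Nat.lt_floor_add_one ((2 : ℝ) ^ (N * z))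
    linarith
  have hb : ∀ᶠ N : ℕ in atTop, ((2 : ℝ) ^ (x + y - u)) ^ N ≤ 4 * c := by
    filter_upwards [h] with N hN
    have h1 := mul_le_mul (hhalf N hx) (hhalf N hy) (by positivity) (by positivity)
    rw [Nat.cast_mul] at hN
    have h2 := h1.trans hN
    have hp : (0 : ℝ) < 2 ^ (N * u) := by positivity
    have h3 : (2 : ℝ) ^ (N * x) * 2 ^ (N * y) = (2 ^ (x + y - u)) ^ N * 2 ^ (N * u) := by
      rw [← Real.rpow_natCast, ← Real.rpow_mul zero_le_two, ← Real.rpow_add zero_lt_two,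
        ← Real.rpow_add zero_lt_two]
      congr 1; ring
    refine le_of_mul_le_mul_right ?_ hp
    rw [← h3]; linarith
  have htop : Tendsto (fun N : ℕ => ((2 : ℝ) ^ (x + y - u)) ^ N) atTop atTop :=
    tendsto_pow_atTop_atTop_of_one_lt (Real.one_lt_rpow one_lt_two (by linarith))
  obtain ⟨N, hN1, hN2⟩ := (hb.and (htop.eventually_gt_atTop (4 * c))).exists
  linarith

end Messages

/-! ### Three states with the same local views -/

namespace LayeredNetwork

variable {K : ℕ} {ρ : Type*} {net : LayeredNetwork K ρ}

/-- In the states `sa` and `sb` only the users `a` and `b`, respectively, can communicate, and the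
sources `S_a` and `S_b` cannot tell these states from `s`. -/
lemma AttainsFraction.two_mul_le {h : ℕ} {σ G A : Type*} {gain : σ → net.Edge → G}
    {reliable : σ → ((N : ℕ) → NetCode K ρ A N) → (Fin K → ℝ) → Prop} {α τ : ℝ}
    (att : net.AttainsFraction h gain reliable α τ) (hα : 0 ≤ α) {a b : Fin K} {s sa sb : σ}
    (hva : net.SameView h (.src a) (gain sa) (gain s))
    (hvb : net.SameView h (.src b) (gain sb) (gain s))
    (hza : ∀ c R, reliable sa c R → ∀ i, i ≠ a → R i = 0)
    (hzb : ∀ c R, reliable sb c R → ∀ i, i ≠ b → R i = 0)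
    {C U : ℝ} (hCa : (C : EReal) ≤ sumCapacity (reliable sa))
    (hCb : (C : EReal) ≤ sumCapacity (reliable sb))
    (hU : ∀ c R, reliable s c R → R a + R b ≤ U) : 2 * (α * C) ≤ U + 2 * τ := by
  obtain ⟨R, c, hloc, hrel⟩ := att
  -- In the state `t` the whole sum-rate belongs to user `i`, and by locality this user keeps the
  -- same rate in `s`.
  have key : ∀ (i : Fin K) (t : σ), net.SameView h (.src i) (gain t) (gain s) →
      (∀ c R, reliable t c R → ∀ k, k ≠ i → R k = 0) →
      (C : EReal) ≤ sumCapacity (reliable t) → α * C ≤ R s i + τ := by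
    intro i t hv hz hC
    have h1 := (hrel t).2
    rw [Finset.sum_eq_single i (fun k _ hk => hz _ _ (hrel t).1 k hk) (by simp),
      ((hloc t s).1 i hv).1] at h1
    have h2 := (mul_le_mul_of_nonneg_left hC (EReal.coe_nonneg.2 hα)).trans h1
    exact_mod_cast h2
  have h1 := key a sa hva hza hCa
  have h2 := key b sb hvb hzb hCb
  have h3 := hU _ _ (hrel s).1
  linarith

/-! ### Forwarding along a single route -/

open Classical in
/-- The source `S_b` sends the modulated symbols of a codeword, the relays on the route `r` forward
what they hear, symbol by symbol, and all other nodes are silent. -/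
noncomputable def routeCode {A B : Type*} [Zero A] (net : LayeredNetwork K ρ) (b : Fin K)
    (r : ℕ → Node K ρ) (mod : B → A) (demod : A → B) (C : ℕ → ℕ → B) (N : ℕ)
    (Dec : (Fin (N - (net.L - 2)) → B) → ℕ) : NetCode K ρ A N where
  enc i m t := if i = b then mod (C m t) else 0
  relay q t y := if h : (∃ l, 1 ≤ l ∧ l ≤ net.L ∧ r l = .relay q) ∧ 0 < t then
    mod (demod (y ⟨t - 1, by omega⟩)) else 0
  -- Each of the `L - 2` relays on the route delays a symbol by one time unit. The value `0` is the
  -- only message of a user with rate `0`.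
  dec i y := if i = b then Dec fun k => demod (y ⟨k + (net.L - 2), by omega⟩) else 0

section RouteCode

variable {A B : Type*} [Zero A] {b : Fin K} {r : ℕ → Node K ρ} {mod : B → A} {demod : A → B}
  {C : ℕ → ℕ → B} {N : ℕ} {Dec : (Fin (N - (net.L - 2)) → B) → ℕ}
  {recv : ℕ → (Node K ρ → A) → Node K ρ → A} {m : Fin K → ℕ}

lemma routeCode_input_mem (t : ℕ) (u : Node K ρ) :
    (routeCode net b r mod demod C N Dec).input recv m t u = 0 ∨
      ∃ x, (routeCode net b r mod demod C N Dec).input recv m t u = mod x := by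
  cases u with
  | src i =>
    simp only [NetCode.input, NetCode.send, routeCode]
    split_ifs
    exacts [Or.inr ⟨_, rfl⟩, Or.inl rfl]
  | relay q =>
    simp only [NetCode.input, NetCode.send, routeCode]
    split_ifs
    exacts [Or.inr ⟨_, rfl⟩, Or.inl rfl]
  | dst i => exact Or.inl rfl

lemma routeCode_input_eq_zero (hr : net.IsPath b b r) (t : ℕ) {u : Node K ρ}
    (hu : ∀ l, 1 ≤ l → l ≤ net.L → u ≠ r l) :
    (routeCode net b r mod demod C N Dec).input recv m t u = 0 := by
  cases u with
  | src i =>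
    simp only [NetCode.input, NetCode.send, routeCode]
    rw [if_neg]
    rintro rfl
    exact hu 1 le_rfl (one_le_two.trans net.two_le) hr.start.symm
  | relay q =>
    simp only [NetCode.input, NetCode.send, routeCode]
    rw [dif_neg]
    rintro ⟨⟨l, h1, h2, h⟩, -⟩
    exact hu l h1 h2 h.symm
  | dst i => rfl

/-- A symbol is delivered if each hop delivers it. -/
lemma routeCode_demod_received (hr : net.IsPath b b r) {k : ℕ}
    (hgood : ∀ j, j + 2 ≤ net.L → ∀ X : Node K ρ → A,
      (∀ u, net.layer u = j + 1 → u ≠ r (j + 1) → X u = 0) →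
      X (r (j + 1)) = mod (C (m b) k) → demod (recv (k + j) X (r (j + 2))) = C (m b) k)
    (hk : k + (net.L - 2) < N) :
    demod ((routeCode net b r mod demod C N Dec).received recv m N (.dst b)
      ⟨k + (net.L - 2), hk⟩) = C (m b) k := by
  have hL := net.two_le
  have hzero : ∀ t j, j + 2 ≤ net.L → ∀ u, net.layer u = j + 1 → u ≠ r (j + 1) →
      (routeCode net b r mod demod C N Dec).input recv m t u = 0 := by
    intro t j hj u hu hne
    refine routeCode_input_eq_zero hr t fun l h1 h2 h => hne ?_
    have := hr.layer h1 h2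
    rw [← h, hu] at this
    rw [h, this]
  -- The node in layer `j + 1` of the route sends the `k`-th symbol at time `k + j`.
  have key : ∀ j, j + 2 ≤ net.L →
      (routeCode net b r mod demod C N Dec).input recv m (k + j) (r (j + 1)) =
        mod (C (m b) k) := by
    intro j
    induction j with
    | zero =>
      intro _
      rw [zero_add, hr.start]
      simp [NetCode.input, NetCode.send, routeCode]
    | succ j ih =>
      intro hj
      have h1 := hgood j (by omega) _ (hzero (k + j) j (by omega)) (ih (by omega))
      have hlay : net.layer (r (j + 2)) = j + 2 := hr.layer (by omega) (by omega)
      rw [show j + 1 + 1 = j + 2 from rfl, show k + (j + 1) = k + j + 1 from rfl]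
      rw [NetCode.input]
      have hrec := NetCode.received_apply (routeCode net b r mod demod C N Dec) recv m
        (r (j + 2)) (Fin.last (k + j))
      simp only [Fin.val_last] at hrec
      cases hq : r (j + 2) with
      | src i => rw [hq] at hlay; simp [layer] at hlay
      | dst i => rw [hq] at hlay; simp [layer] at hlay; omega
      | relay q =>
        rw [hq] at hrec h1
        simp only [NetCode.send]
        generalize (routeCode net b r mod demod C N Dec).received recv m (k + j + 1)
          (.relay q) = y at hrec
        simp only [routeCode]
        rw [dif_pos ⟨⟨j + 2, by omega, by omega, hq⟩, by omega⟩]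
        congr 1
        rw [← h1, ← hrec]
        rfl
  rw [NetCode.received_apply]
  have h1 := hgood (net.L - 2) (by omega) _ (hzero (k + (net.L - 2)) _ (by omega))
    (key (net.L - 2) (by omega))
  rwa [show net.L - 2 + 2 = net.L by omega, hr.finish] at h1

end RouteCode

end LayeredNetwork

namespace LayeredNetwork

variable {K : ℕ} {ρ : Type*} [Fintype ρ] {net : LayeredNetwork K ρ}

/-! ### Signals on active links -/

open Classical in
variable (net) in
/-- The sum of the inputs `X_u` over the active links `(u, v)`. -/
noncomputable def activeSum {A : Type*} [AddCommMonoid A] (act : Node K ρ → Node K ρ → Prop)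
    (X : Node K ρ → A) (v : Node K ρ) : A :=
  ∑ e : net.Edge with e.1.2 = v, if act e.1.1 e.1.2 then X e.1.1 else 0

section ActiveSum

variable {A : Type*} [AddCommMonoid A] {act : Node K ρ → Node K ρ → Prop}
  {X X' : Node K ρ → A} {v : Node K ρ}

lemma activeSum_congr (h : ∀ u, act u v → X u = X' u) :
    net.activeSum act X v = net.activeSum act X' v := by
  classical
  refine Finset.sum_congr rfl fun e he => ?_
  obtain rfl : e.1.2 = v := by simpa using he
  split_ifs with h1
  exacts [h _ h1, rfl]

open Classical in
lemma activeSum_eq_sum (hadj : ∀ u v, act u v → net.Adj u v) :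
    net.activeSum act X v = ∑ u with act u v, X u := by
  rw [activeSum, ← Finset.sum_filter, Finset.filter_filter]
  refine Finset.sum_bij (fun e _ => e.1.1) ?_ ?_ ?_ (fun _ _ => rfl)
  · intro e he
    simp only [Finset.mem_filter, Finset.mem_univ, true_and] at he ⊢
    rw [← he.1]; exact he.2
  · intro e he e' he' h
    simp only [Finset.mem_filter, Finset.mem_univ, true_and] at he he'
    exact Subtype.ext (Prod.ext h (he.1.trans he'.1.symm))
  · intro u hu
    simp only [Finset.mem_filter, Finset.mem_univ, true_and] at hu
    exact ⟨⟨(u, v), hadj _ _ hu⟩, by simp [hu], rfl⟩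

lemma activeSum_eq_single (hadj : ∀ u v, act u v → net.Adj u v) {p : Node K ρ} (hp : act p v)
    (h : ∀ u, act u v → u ≠ p → X u = 0) : net.activeSum act X v = X p := by
  classical
  rw [activeSum_eq_sum hadj]
  refine Finset.sum_eq_single p ?_ ?_
  · intro u hu hne
    exact h u (by simpa using hu) hne
  · intro hnot
    exact absurd (by simpa using hp) hnot

lemma activeSum_eq_add (hadj : ∀ u v, act u v → net.Adj u v) {p f : Node K ρ} (hpf : p ≠ f)
    (h : ∀ u, act u v ↔ u = p ∨ u = f) : net.activeSum act X v = X p + X f := by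
  classical
  rw [activeSum_eq_sum hadj, ← Finset.sum_pair hpf]
  congr 1
  ext u
  simp [h u]

end ActiveSum

/-! ### Silencing one of the two flows -/

namespace MeetingFlows

variable {a b : Fin K} (M : net.MeetingFlows a b)

/-- The active links that do not start at `S_c`. -/
def ActiveWithout (c : Fin K) (u v : Node K ρ) : Prop := M.Active u v ∧ u ≠ .src c

omit [Fintype ρ] in
lemma not_activeWithout_left {i : Fin K} (hi : i ≠ b) (v : Node K ρ) :
    ¬ M.ActiveWithout a (.src i) v := by
  rintro ⟨h1, h2⟩
  rcases M.active_src i v h1 with rfl | rfl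
  exacts [h2 rfl, hi rfl]

omit [Fintype ρ] in
lemma not_activeWithout_right {i : Fin K} (hi : i ≠ a) (v : Node K ρ) :
    ¬ M.ActiveWithout b (.src i) v := by
  rintro ⟨h1, h2⟩
  rcases M.active_src i v h1 with rfl | rfl
  exacts [hi rfl, h2 rfl]

omit [Fintype ρ] in
lemma not_active_src {i : Fin K} (ha : i ≠ a) (hb : i ≠ b) (v : Node K ρ) :
    ¬ M.Active (.src i) v := by
  intro h
  rcases M.active_src i v h with rfl | rfl
  exacts [ha rfl, hb rfl]

omit [Fintype ρ] in
lemma activeWithout_of_isPath {i c : Fin K} (hic : i ≠ c) {r : ℕ → Node K ρ}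
    (hr : net.IsPath i i r) (h : ∀ l, 1 ≤ l → l < net.L → M.Active (r l) (r (l + 1))) :
    ∀ l, 1 ≤ l → l < net.L → M.ActiveWithout c (r l) (r (l + 1)) := by
  intro l h1 h2
  refine ⟨h l h1 h2, fun h3 => ?_⟩
  have h4 := hr.layer h1 h2.le
  rw [h3] at h4
  change 1 = l at h4
  subst h4
  rw [hr.start] at h3
  exact hic (Node.src.inj h3)

end MeetingFlows

-- The two states differ only in links that leave `S_d`, and none of these is in the view of `S_c`.
omit [Fintype ρ] in
open Classical in
lemma sameView_activeWithout {a b c d : Fin K} (M : net.MeetingFlows a b) (hcd : c ≠ d)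
    {G : Type*} (x y : G) :
    net.SameView 1 (.src c) (fun e => if M.ActiveWithout d e.1.1 e.1.2 then x else y)
      (fun e => if M.Active e.1.1 e.1.2 then x else y) := by
  intro e he
  have : e.1.1 ≠ .src d := fun h => hcd (eq_of_mem_sourceView_one he h).symm
  simp [MeetingFlows.ActiveWithout, this]

end LayeredNetwork

/-! ### Linear deterministic model: on-off states, forwarding, converse -/

namespace LinDet

open LayeredNetwork

variable {K : ℕ} {ρ : Type*} [Fintype ρ] {net : LayeredNetwork K ρ} {q : ℕ}

lemma shift_pow_apply (q k : ℕ) (i j : Fin q) :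
    (shift q ^ k) i j = if (i : ℕ) = j + k then 1 else 0 := by
  induction k generalizing i with
  | zero => simp [Matrix.one_apply, Fin.ext_iff]
  | succ k ih =>
    have hs : ∀ i l, shift q i l = if (i : ℕ) = l + 1 then 1 else 0 := fun _ _ => rfl
    rw [pow_succ', Matrix.mul_apply]
    simp only [ih, hs]
    by_cases h : (i : ℕ) = j + (k + 1)
    · rw [if_pos h, Finset.sum_eq_single ⟨j + k, by omega⟩]
      · simp [h, add_assoc]
      · intro l _ hl
        have : (l : ℕ) ≠ j + k := fun h' => hl (Fin.ext h')
        simp [this]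
      · simp
    · rw [if_neg h]
      refine Finset.sum_eq_zero fun l _ => ?_
      by_cases h1 : (l : ℕ) = j + k
      · rw [if_neg (by omega), zero_mul]
      · rw [if_neg h1, mul_zero]

lemma shift_pow_self (q : ℕ) : shift q ^ q = 0 := by
  ext i j
  rw [shift_pow_apply, if_neg (by omega)]
  rfl

open Classical in
/-- The state in which the active links have gain `q` and the others have gain `0`. -/
noncomputable def onOffState (act : Node K ρ → Node K ρ → Prop)
    (hact : ∃ e : net.Edge, act e.1.1 e.1.2) (q : ℕ) : State net q :=
  ⟨fun e => if act e.1.1 e.1.2 then q else 0, by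
    obtain ⟨e, he⟩ := hact
    refine le_antisymm (Finset.sup_le fun e _ => ?_) ?_
    · split_ifs <;> simp
    · exact (Finset.le_sup (f := fun e : net.Edge => if act e.1.1 e.1.2 then q else 0)
        (Finset.mem_univ e)).trans' (by simp [he])⟩

variable {act : Node K ρ → Node K ρ → Prop} {hact : ∃ e : net.Edge, act e.1.1 e.1.2}

lemma recv_onOffState (X : Node K ρ → Fin q → ZMod 2) (v : Node K ρ) :
    recv (onOffState act hact q) X v = net.activeSum act X v := by
  classical
  rw [recv, activeSum]
  refine Finset.sum_congr rfl fun e _ => ?_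
  by_cases h : act e.1.1 e.1.2
  · simp [onOffState, h]
  · simp [onOffState, h, shift_pow_self]

/-- A message of a source that nobody hears does not influence the estimate, so of two tuples
differing only in it at most one is decoded correctly. The error is thus at least `1/2` once there
are two messages. -/
lemma rate_eq_zero_of_silent {i : Fin K} (hi : ∀ v, ¬ act (.src i) v)
    {c : (N : ℕ) → NetCode K ρ (Fin q → ZMod 2) N} {R : Fin K → ℝ}
    (h : Reliable (onOffState act hact q) c R) : R i = 0 := by
  classical
  refine rate_eq_zero (h.1 i) (h.2 i) fun N hN => ?_
  set s := onOffState act hact q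
  have hupd : ∀ m k, (c N).decoded (fun _ => recv s) (Function.update m i k) i =
      (c N).decoded (fun _ => recv s) m i := fun m k => by
    refine (c N).decoded_update (fun t X X' v hX => ?_) m k i
    rw [recv_onOffState, recv_onOffState]
    refine activeSum_congr fun u hu => hX u ?_
    rintro rfl
    exact hi v hu
  have key := messages_card_le_two_mul_sum hN
    (fun m => if (c N).decoded (fun _ => recv s) m i ≠ m i then (1 : ℝ) else 0) ?_
  · have hpos : (0 : ℝ) < (messages N R).card := by exact_mod_cast messages_card_pos h.1
    rw [errorProb, le_div_iff₀ hpos]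
    rw [Finset.sum_boole] at key
    linarith
  · intro m k hk
    simp only [hupd, Function.update_self]
    by_cases h1 : (c N).decoded (fun _ => recv s) m i = m i
    · rw [h1]; simp [hk.symm]
    · simp only [ne_eq, h1, not_false_eq_true, if_true]
      split_ifs <;> norm_num

/-- Along the route every hop is noiseless and carries `q` bits per use. Rate `q - 1` leaves `N`
spare bits, which pay for the `q (L - 2)` bits lost to the delay once `N ≥ q (L - 2)`; the error is
then exactly `0`. -/
lemma le_sumCapacity_of_route (hadj : ∀ u v, act u v → net.Adj u v) {b : Fin K}
    {r : ℕ → Node K ρ} (hr : net.IsPath b b r)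
    (hroute : ∀ l, 1 ≤ l → l < net.L → act (r l) (r (l + 1))) (hq : 1 ≤ q) :
    (((q : ℝ) - 1 : ℝ) : EReal) ≤ sumCapacity (Reliable (onOffState act hact q)) := by
  classical
  set s := onOffState act hact q
  let W : ℕ → Type := fun n => Fin n → Fin q → ZMod 2
  let C : (n : ℕ) → ℕ → ℕ → Fin q → ZMod 2 := fun n m k =>
    if h : m < Fintype.card (W n) ∧ k < n then (Fintype.equivFin (W n)).symm ⟨m, h.1⟩ ⟨k, h.2⟩
    else 0
  let c : (N : ℕ) → NetCode K ρ (Fin q → ZMod 2) N := fun N =>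
    routeCode net b r id id (C (N - (net.L - 2))) N
      (fun w => (Fintype.equivFin (W (N - (net.L - 2))) w : ℕ))
  let R : Fin K → ℝ := fun i => if i = b then (q : ℝ) - 1 else 0
  have hq' : (1 : ℝ) ≤ q := by exact_mod_cast hq
  refine le_sSup ⟨c, R, ⟨?_, ?_⟩, by simp [R]⟩
  · intro i
    simp only [R]
    split_ifs <;> linarith
  · intro i
    refine tendsto_const_nhds.congr' ?_
    filter_upwards [eventually_ge_atTop (q * (net.L - 2))] with N hN
    have hempty : (messages N R).filter (fun m => (c N).decoded (fun _ => recv s) m i ≠ m i)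
        = ∅ := by
      refine Finset.filter_eq_empty_iff.2 fun m hm => not_not.2 ?_
      by_cases hi : i = b
      · subst hi
        have hlt : m i < Fintype.card (W (N - (net.L - 2))) := by
          have h1 := mem_messages.1 hm i
          refine h1.trans_le ?_
          have h2 : (2 : ℝ) ^ ((N : ℝ) * R i) = ((2 ^ (N * (q - 1)) : ℕ) : ℝ) := by
            rw [Nat.cast_pow, ← Real.rpow_natCast]
            simp [R, Nat.cast_sub hq]
          rw [h2, Nat.floor_natCast]
          simp only [W, Fintype.card_fun, ZMod.card, Fintype.card_fin]
          rw [← pow_mul]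
          refine Nat.pow_le_pow_right two_pos ?_
          rw [Nat.mul_sub, Nat.mul_sub, mul_one, mul_comm q N]
          have : N ≤ N * q := Nat.le_mul_of_pos_right _ hq
          omega
        change (if i = i then _ else 0) = m i
        rw [if_pos rfl]
        have : (fun k : Fin (N - (net.L - 2)) => id ((c N).received (fun _ => recv s) m N (.dst i)
            ⟨k + (net.L - 2), by omega⟩)) =
            (Fintype.equivFin (W (N - (net.L - 2)))).symm ⟨m i, hlt⟩ := by
          funext k
          refine (routeCode_demod_received hr ?_ (by omega)).trans ?_
          · intro j hj X hX hXr
            rw [id, recv_onOffState, activeSum_eq_single hadj (hroute (j + 1) (by omega) hj), hXr]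
            · rfl
            · intro u hu hne
              refine hX u ?_ hne
              have h1 := layer_of_adj (hadj _ _ hu)
              rw [hr.layer (by omega) (by omega)] at h1
              omega
          · simp only [C]
            rw [dif_pos ⟨hlt, k.2⟩]
        rw [this]
        simp
      · have hm0 : m i = 0 := messages_apply_of_rate_zero hm (by simp [R, hi])
        rw [hm0]
        change (if i = b then _ else 0) = 0
        rw [if_neg hi]
    rw [errorProb, hempty]
    simp

section Converse

variable {a b : Fin K} (M : net.MeetingFlows a b)
  {hact : ∃ e : net.Edge, M.Active e.1.1 e.1.2}

-- The destination `D_b` is a function of the signal at `x`, which fixes `m b`. This fixes the input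
-- of `f`, and subtracting it leaves the input of `p`. Hence the signal at `κ` is also fixed, and
-- with it `m a`.
include M in
lemma eq_of_received_eq {N : ℕ} {c : NetCode K ρ (Fin q → ZMod 2) N} {m m' : Fin K → ℕ}
    (ha : c.decoded (fun _ => recv (onOffState M.Active hact q)) m a = m a)
    (ha' : c.decoded (fun _ => recv (onOffState M.Active hact q)) m' a = m' a)
    (hb : c.decoded (fun _ => recv (onOffState M.Active hact q)) m b = m b)
    (hb' : c.decoded (fun _ => recv (onOffState M.Active hact q)) m' b = m' b)
    (h : c.received (fun _ => recv (onOffState M.Active hact q)) m N M.x =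
      c.received (fun _ => recv (onOffState M.Active hact q)) m' N M.x) :
    m a = m' a ∧ m b = m' b := by
  set s := onOffState M.Active hact q
  have hx : ∀ t < N, recv s (c.input (fun _ => recv s) m t) M.x =
      recv s (c.input (fun _ => recv s) m' t) M.x := by
    intro t ht
    have := congrFun h ⟨t, ht⟩
    rwa [NetCode.received_apply, NetCode.received_apply] at this
  have hclosed : ∀ {X X' : Node K ρ → Fin q → ZMod 2} {S : Set (Node K ρ)} {v : Node K ρ},
      (∀ u, M.Active u v → u ∈ S) → (∀ u ∈ S, X u = X' u) → recv s X v = recv s X' v := by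
    intro X X' S v hS hX
    rw [recv_onOffState, recv_onOffState]
    exact activeSum_congr fun u hu => hX u (hS u hu)
  have hbb : m b = m' b := by
    have hTB := c.received_congr (recv := fun _ => recv s) (recv' := fun _ => recv s)
      (m := m) (m' := m') M.TB (T := N) (fun i hi => absurd hi (M.TB_src i)) ?_ N le_rfl _
      M.dst_mem_TB
    · rw [← hb, ← hb', NetCode.decoded, NetCode.decoded, hTB.1]
    · intro t ht hX v hv
      by_cases hvx : v = M.x
      · rw [hvx]; exact hx t ht
      · exact hclosed (fun u hu => M.TB_closed u v hu hv hvx) hX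
  have hf : ∀ t ≤ N, c.input (fun _ => recv s) m t M.f = c.input (fun _ => recv s) m' t M.f := by
    intro t ht
    refine (c.received_congr (recv := fun _ => recv s) (recv' := fun _ => recv s)
      (m := m) (m' := m') M.SB (T := N) ?_ ?_ t ht _ M.f_mem).2
    · intro i hi
      rw [M.SB_src i hi, hbb]
    · intro t ht hX v hv
      exact hclosed (fun u hu => M.SB_closed u v hu hv) hX
  have hp : ∀ t < N, c.input (fun _ => recv s) m t M.p = c.input (fun _ => recv s) m' t M.p := by
    intro t ht
    have := hx t ht
    rw [recv_onOffState, recv_onOffState, activeSum_eq_add M.adj M.p_ne_f M.active_x,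
      activeSum_eq_add M.adj M.p_ne_f M.active_x, hf t ht.le] at this
    exact add_right_cancel this
  refine ⟨?_, hbb⟩
  have hTA := c.received_congr (recv := fun _ => recv s) (recv' := fun _ => recv s)
    (m := m) (m' := m') M.TA (T := N) (fun i hi => absurd hi (M.TA_src i)) ?_ N le_rfl _
    M.dst_mem_TA
  · rw [← ha, ← ha', NetCode.decoded, NetCode.decoded, hTA.1]
  · intro t ht hX v hv
    by_cases hvx : v = M.κ
    · rw [hvx]
      by_cases hκ : M.κ = M.x
      · rw [hκ]; exact hx t ht
      · refine hclosed (S := {M.p}) (fun u hu => (M.active_κ hκ u).1 hu) ?_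
        rintro u rfl
        exact hp t ht
    · exact hclosed (fun u hu => M.TA_closed u v hu hv hvx) hX

-- Correctly decoded tuples inject into the `2 ^ (N q)` signals at `x`. Error probabilities below
-- `1/4` for each user leave at least half of all tuples, whence the constant `2`.
include M in
lemma rate_add_rate_le (hab : a ≠ b) {c : (N : ℕ) → NetCode K ρ (Fin q → ZMod 2) N}
    {R : Fin K → ℝ} (h : Reliable (onOffState M.Active hact q) c R) : R a + R b ≤ q := by
  classical
  have hzero : ∀ i, i ≠ a → i ≠ b → R i = 0 := fun i hia hib =>
    rate_eq_zero_of_silent (M.not_active_src hia hib) h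
  refine rate_add_le (c := 2) (h.1 a) (h.1 b) ?_
  filter_upwards [(h.2 a).eventually (gt_mem_nhds (show (0 : ℝ) < 1 / 4 by norm_num)),
    (h.2 b).eventually (gt_mem_nhds (show (0 : ℝ) < 1 / 4 by norm_num))] with N hNa hNb
  rw [← messages_card_of_two hab hzero]
  set s := onOffState M.Active hact q
  have hpos : (0 : ℝ) < (messages N R).card := by exact_mod_cast messages_card_pos h.1
  rw [errorProb, div_lt_iff₀ hpos] at hNa hNb
  set Ea := (messages N R).filter fun m => (c N).decoded (fun _ => recv s) m a ≠ m a
  set Eb := (messages N R).filter fun m => (c N).decoded (fun _ => recv s) m b ≠ m b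
  have hG : ((messages N R).filter fun m => (c N).decoded (fun _ => recv s) m a = m a ∧
      (c N).decoded (fun _ => recv s) m b = m b).card ≤
      Fintype.card (Fin N → Fin q → ZMod 2) := by
    refine Finset.card_le_card_of_injOn
      (fun m => (c N).received (fun _ => recv s) m N M.x) (fun _ _ => Finset.mem_univ _) ?_
    intro m hm m' hm' heq
    simp only [Finset.coe_filter, Set.mem_ofPred_eq] at hm hm'
    obtain ⟨h1, h2⟩ := eq_of_received_eq M hm.2.1 hm'.2.1 hm.2.2 hm'.2.2 heq
    exact messages_ext hzero hm.1 hm'.1 h1 h2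
  have hcover : (messages N R).card ≤ ((messages N R).filter fun m =>
      (c N).decoded (fun _ => recv s) m a = m a ∧
      (c N).decoded (fun _ => recv s) m b = m b).card + (Ea.card + Eb.card) := by
    refine (Finset.card_le_card ?_).trans ((Finset.card_union_le _ (Ea ∪ Eb)).trans
      (Nat.add_le_add_left (Finset.card_union_le _ _) _))
    intro m hm
    simp only [Finset.mem_union, Finset.mem_filter, Ea, Eb, hm, true_and]
    tauto
  have hcover' := hcover.trans (Nat.add_le_add_right hG _)
  have hcard : ((Fintype.card (Fin N → Fin q → ZMod 2) : ℕ) : ℝ) = 2 ^ ((N : ℝ) * q) := by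
    simp only [Fintype.card_fun, ZMod.card, Fintype.card_fin]
    rw [← pow_mul, Nat.cast_pow, ← Real.rpow_natCast]
    push_cast
    rw [mul_comm]
  have hreal : ((messages N R).card : ℝ) ≤ 2 ^ ((N : ℝ) * q) + (Ea.card + Eb.card) := by
    rw [← hcard]
    exact_mod_cast hcover'
  linarith

end Converse

end LinDet

/-! ### The bound for the linear deterministic model -/

namespace LayeredNetwork

variable {K : ℕ} {ρ : Type*} [Fintype ρ] {net : LayeredNetwork K ρ}

lemma LinDetAchievable.le_half {a b : Fin K} (hab : a ≠ b) (M : net.MeetingFlows a b) {α : ℝ}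
    (h : net.LinDetAchievable 1 α) : α ≤ 1 / 2 := by
  classical
  rcases le_or_gt α 0 with hα | hα
  · linarith
  obtain ⟨τ, h⟩ := h
  have hL := net.two_le
  obtain ⟨ra, hra, hra'⟩ := M.route_a
  obtain ⟨rb, hrb, hrb'⟩ := M.route_b
  have wa := M.activeWithout_of_isPath hab hra hra'
  have wb := M.activeWithout_of_isPath hab.symm hrb hrb'
  have hact : ∃ e : net.Edge, M.Active e.1.1 e.1.2 :=
    ⟨⟨(ra 1, ra 2), hra.adj 1 le_rfl hL⟩, hra' 1 le_rfl hL⟩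
  have hacta : ∃ e : net.Edge, M.ActiveWithout b e.1.1 e.1.2 :=
    ⟨⟨(ra 1, ra 2), hra.adj 1 le_rfl hL⟩, wa 1 le_rfl hL⟩
  have hactb : ∃ e : net.Edge, M.ActiveWithout a e.1.1 e.1.2 :=
    ⟨⟨(rb 1, rb 2), hrb.adj 1 le_rfl hL⟩, wb 1 le_rfl hL⟩
  have key : ∀ q : ℕ, 1 ≤ q → 2 * (α * ((q : ℝ) - 1)) ≤ q + 2 * τ := by
    intro q hq
    refine (h q).two_mul_le hα.le (s := LinDet.onOffState M.Active hact q)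
      (sa := LinDet.onOffState (M.ActiveWithout b) hacta q)
      (sb := LinDet.onOffState (M.ActiveWithout a) hactb q) (a := a) (b := b)
      (sameView_activeWithout M hab q 0) (sameView_activeWithout M hab.symm q 0) ?_ ?_
      (LinDet.le_sumCapacity_of_route (fun u v h => M.adj u v h.1) hra wa hq)
      (LinDet.le_sumCapacity_of_route (fun u v h => M.adj u v h.1) hrb wb hq)
      (fun c R hc => LinDet.rate_add_rate_le M hab hc)
    · intro c R hc i hi
      exact LinDet.rate_eq_zero_of_silent (M.not_activeWithout_right hi) hc
    · intro c R hc i hi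
      exact LinDet.rate_eq_zero_of_silent (M.not_activeWithout_left hi) hc
  by_contra hlt
  push Not at hlt
  -- If `2 * α > 1`, the left side of `key` grows faster in `q` than the right side.
  obtain ⟨n, hn⟩ := exists_nat_gt ((2 * τ + 2 * α) / (2 * α - 1))
  have hpos : 0 < 2 * α - 1 := by linarith
  rw [div_lt_iff₀ hpos] at hn
  have := key (n + 1) (by omega)
  push_cast at this
  nlinarith

end LayeredNetwork

/-! ### Codes with a large Hamming distance -/

section Hamming

variable {B : Type*} [Fintype B] [DecidableEq B] [Nonempty B] {n : ℕ}

/-- A word at distance at most `d` differs from `x` inside some set of at most `d` places. There are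
at most `2 ^ n` such sets, each allowing at most `|B| ^ d` words. -/
lemma card_hammingDist_le (x : Fin n → B) (d : ℕ) :
    (Finset.univ.filter fun y => hammingDist x y ≤ d).card ≤ 2 ^ n * Fintype.card B ^ d := by
  classical
  let cyl : Finset (Fin n) → Finset (Fin n → B) := fun S =>
    Fintype.piFinset fun i => if i ∈ S then Finset.univ else {x i}
  have hcyl : ∀ S, (cyl S).card = Fintype.card B ^ S.card := by
    intro S
    simp only [cyl, Fintype.card_piFinset]
    rw [← Finset.prod_const, ← Finset.prod_filter_mul_prod_filter_not Finset.univ (· ∈ S)]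
    rw [Finset.prod_congr rfl (g := fun _ => Fintype.card B), mul_comm, Finset.prod_eq_one,
      one_mul]
    · simp
    · intro i hi
      simp only [Finset.mem_filter] at hi
      simp [hi.2]
    · intro i hi
      simp only [Finset.mem_filter] at hi
      simp [hi.2]
  have hsub : (Finset.univ.filter fun y => hammingDist x y ≤ d) ⊆
      (Finset.univ.filter fun S : Finset (Fin n) => S.card ≤ d).biUnion cyl := by
    intro y hy
    simp only [Finset.mem_filter, Finset.mem_univ, true_and] at hy
    simp only [Finset.mem_biUnion, Finset.mem_filter, Finset.mem_univ, true_and]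
    refine ⟨Finset.univ.filter fun i => x i ≠ y i, hy, ?_⟩
    rw [Fintype.mem_piFinset]
    intro i
    by_cases h : x i = y i
    · simp [h]
    · simp [h]
  calc _ ≤ _ := Finset.card_le_card hsub
    _ ≤ ∑ S ∈ Finset.univ.filter (fun S : Finset (Fin n) => S.card ≤ d), (cyl S).card :=
      Finset.card_biUnion_le
    _ ≤ (Finset.univ.filter (fun S : Finset (Fin n) => S.card ≤ d)).card •
        Fintype.card B ^ d := by
      refine Finset.sum_le_card_nsmul _ _ _ fun S hS => ?_
      rw [hcyl]
      exact Nat.pow_le_pow_right Fintype.card_pos (by simpa using hS)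
    _ ≤ 2 ^ n * Fintype.card B ^ d := by
      rw [smul_eq_mul]
      refine Nat.mul_le_mul_right _ ((Finset.card_filter_le _ _).trans ?_)
      simp

/-- The Gilbert–Varshamov bound. -/
lemma exists_code_hammingDist (M d : ℕ)
    (h : M * (2 ^ n * Fintype.card B ^ d) ≤ Fintype.card B ^ n) :
    ∃ C : ℕ → Fin n → B, ∀ m < M, ∀ m' < M, m ≠ m' → d < hammingDist (C m) (C m') := by
  classical
  have key : ∀ k ≤ M, ∃ C : ℕ → Fin n → B, ∀ m < k, ∀ m' < k, m ≠ m' →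
      d < hammingDist (C m) (C m') := by
    intro k
    induction k with
    | zero => exact fun _ => ⟨fun _ _ => Classical.arbitrary B, by simp⟩
    | succ k ih =>
      intro hk
      obtain ⟨C, hC⟩ := ih (by omega)
      have hV : 0 < 2 ^ n * Fintype.card B ^ d :=
        Nat.mul_pos (by positivity) (pow_pos Fintype.card_pos _)
      -- Greedy choice: fewer than `M` balls of radius `d` cannot cover the space, so another word
      -- can be added.
      have hcard : ((Finset.range k).biUnion fun m =>
          Finset.univ.filter fun y => hammingDist (C m) y ≤ d).card <
          (Finset.univ : Finset (Fin n → B)).card := by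
        calc _ ≤ ∑ m ∈ Finset.range k,
              (Finset.univ.filter fun y => hammingDist (C m) y ≤ d).card := Finset.card_biUnion_le
          _ ≤ k * (2 ^ n * Fintype.card B ^ d) := by
            refine (Finset.sum_le_card_nsmul _ _ _ fun m _ => card_hammingDist_le (C m) d).trans ?_
            simp
          _ < M * (2 ^ n * Fintype.card B ^ d) := Nat.mul_lt_mul_of_pos_right (by omega) hV
          _ ≤ _ := by simpa using h
      obtain ⟨y, -, hy⟩ := Finset.exists_mem_notMem_of_card_lt_card hcard
      simp only [Finset.mem_biUnion, Finset.mem_range, Finset.mem_filter, Finset.mem_univ,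
        true_and, not_exists, not_and, not_le] at hy
      refine ⟨Function.update C k y, fun m hm m' hm' hne => ?_⟩
      by_cases h1 : m = k <;> by_cases h2 : m' = k
      · exact absurd (h1.trans h2.symm) hne
      · rw [h1, Function.update_self, Function.update_of_ne h2, hammingDist_comm]
        exact hy m' (by omega)
      · rw [h2, Function.update_self, Function.update_of_ne h1]
        exact hy m (by omega)
      · rw [Function.update_of_ne h1, Function.update_of_ne h2]
        exact hC m (by omega) m' (by omega) hne
  exact key M le_rfl

/-- A code with `M` words that corrects `e` errors. -/
lemma exists_code_decoder (M e : ℕ)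
    (h : M * (2 ^ n * Fintype.card B ^ (2 * e)) ≤ Fintype.card B ^ n) :
    ∃ (C : ℕ → Fin n → B) (D : (Fin n → B) → ℕ), ∀ m < M, ∀ w, hammingDist w (C m) ≤ e →
      D w = m := by
  classical
  obtain ⟨C, hC⟩ := exists_code_hammingDist M (2 * e) h
  refine ⟨C, fun w => if h : ∃ m, m < M ∧ hammingDist w (C m) ≤ e then h.choose else 0,
    fun m hm w hw => ?_⟩
  have hex : ∃ m, m < M ∧ hammingDist w (C m) ≤ e := ⟨m, hm, hw⟩
  simp only [dif_pos hex]
  by_contra hne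
  have h1 := hC _ hex.choose_spec.1 m hm hne
  have h2 := hammingDist_triangle_left (C hex.choose) (C m) w
  have h3 := hex.choose_spec.2
  omega

end Hamming

namespace Gauss

/-! ### Large noise values are rare -/

instance instIsProbabilityMeasureNoise (K : ℕ) (ρ : Type*) : IsProbabilityMeasure (noise K ρ) := by
  unfold noise; infer_instance

/-- The spacing `g` depends on `ε` alone and therefore stays fixed while the channel gain grows. -/
lemma exists_complexGaussian_tail_le {ε : ℝ} (hε : 0 < ε) :
    ∃ g : ℕ, 1 ≤ g ∧ complexGaussian.real {z | (g : ℝ) / 2 ≤ ‖z‖} ≤ ε := by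
  have hanti : Antitone fun g : ℕ => {z : ℂ | (g : ℝ) / 2 ≤ ‖z‖} := by
    intro g g' h z hz
    have : (g : ℝ) ≤ g' := by exact_mod_cast h
    simp only [Set.mem_ofPred_eq] at hz ⊢
    linarith
  have hempty : ⋂ g : ℕ, {z : ℂ | (g : ℝ) / 2 ≤ ‖z‖} = ∅ := by
    rw [Set.eq_empty_iff_forall_notMem]
    intro z hz
    obtain ⟨g, hg⟩ := exists_nat_gt (2 * ‖z‖)
    have := Set.mem_iInter.1 hz g
    simp only [Set.mem_ofPred_eq] at this
    linarith
  have h := tendsto_measure_iInter_atTop (μ := complexGaussian)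
    (s := fun g : ℕ => {z : ℂ | (g : ℝ) / 2 ≤ ‖z‖})
    (fun g => (measurableSet_le measurable_const measurable_norm).nullMeasurableSet) hanti
    ⟨0, measure_ne_top _ _⟩
  rw [hempty, measure_empty] at h
  have h' := (ENNReal.tendsto_toReal ENNReal.zero_ne_top).comp h
  have := (h'.eventually (gt_mem_nhds (show (0 : ℝ≥0∞).toReal < ε by simpa using hε))).and
    (eventually_ge_atTop 1)
  obtain ⟨g, hg1, hg2⟩ := this.exists
  exact ⟨g, hg2, hg1.le⟩

-- Union bound over the sets of `e + 1` indices, of which there are at most `2 ^ |I|`, with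
-- independence inside each set.
open Classical in
lemma noise_real_card_lt_le {K : ℕ} {ρ : Type*} (I : Finset (ℕ × Node K ρ)) (e : ℕ) (x : ℝ) :
    (noise K ρ).real {z | e < (I.filter fun i => x ≤ ‖z i‖).card} ≤
      2 ^ I.card * complexGaussian.real {z | x ≤ ‖z‖} ^ (e + 1) := by
  set p := complexGaussian.real {z | x ≤ ‖z‖}
  have hmeas : MeasurableSet {z : ℂ | x ≤ ‖z‖} := measurableSet_le measurable_const measurable_norm
  have hsub : {z : ℕ × Node K ρ → ℂ | e < (I.filter fun i => x ≤ ‖z i‖).card} ⊆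
      ⋃ S ∈ I.powersetCard (e + 1), Set.pi (S : Set (ℕ × Node K ρ)) fun _ => {z : ℂ | x ≤ ‖z‖} := by
    intro z hz
    obtain ⟨S, hS, hcard⟩ := Finset.exists_subset_card_eq (Nat.succ_le_of_lt hz)
    simp only [Set.mem_iUnion]
    refine ⟨S, Finset.mem_powersetCard.2 ⟨hS.trans (Finset.filter_subset _ _), hcard⟩, ?_⟩
    intro i hi
    exact (Finset.mem_filter.1 (hS hi)).2
  calc _ ≤ _ := measureReal_mono hsub (measure_ne_top _ _)
    _ ≤ ∑ S ∈ I.powersetCard (e + 1), (noise K ρ).real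
        (Set.pi (S : Set (ℕ × Node K ρ)) fun _ => {z : ℂ | x ≤ ‖z‖}) :=
      measureReal_biUnion_finset_le _ _
    _ = ∑ S ∈ I.powersetCard (e + 1), p ^ (e + 1) := by
      refine Finset.sum_congr rfl fun S hS => ?_
      rw [measureReal_def, noise, Measure.infinitePi_pi _ (fun _ _ => hmeas), Finset.prod_const,
        ENNReal.toReal_pow, (Finset.mem_powersetCard.1 hS).2]
      rfl
    _ ≤ 2 ^ I.card * p ^ (e + 1) := by
      rw [Finset.sum_const, Finset.card_powersetCard, nsmul_eq_mul]
      refine mul_le_mul_of_nonneg_right ?_ (by positivity)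
      exact_mod_cast Nat.choose_le_two_pow _ _

/-! ### Quadrature amplitude modulation -/

/-- The points of an `s × s` square grid in the unit disc. -/
noncomputable def qamMod (s : ℕ) (x : Fin s × Fin s) : ℂ :=
  ⟨(x.1 : ℝ) / (2 * s), (x.2 : ℝ) / (2 * s)⟩

/-- Rounding to the grid with spacing `g`. -/
noncomputable def qamDemod (s g : ℕ) [NeZero s] (y : ℂ) : Fin s × Fin s :=
  (Fin.ofNat s ⌊y.re / g + 1 / 2⌋₊, Fin.ofNat s ⌊y.im / g + 1 / 2⌋₊)

lemma norm_qamMod_le {s : ℕ} (x : Fin s × Fin s) : ‖qamMod s x‖ ≤ 1 := by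
  have hs : 0 < s := x.1.pos
  have key : ∀ i : Fin s, |(i : ℝ) / (2 * s)| ≤ 1 / 2 := by
    intro i
    have h1 : (0 : ℝ) < s := by exact_mod_cast hs
    have h2 : ((i : ℕ) : ℝ) ≤ s := by exact_mod_cast i.2.le
    rw [abs_of_nonneg (by positivity), div_le_iff₀ (by positivity)]
    linarith
  refine (Complex.norm_le_abs_re_add_abs_im _).trans ?_
  have h1 := key x.1
  have h2 := key x.2
  simp only [qamMod]
  linarith

lemma measurable_qamDemod (s g : ℕ) [NeZero s] : Measurable (qamDemod s g) := by
  have h : Measurable (fun n : ℕ => (Fin.ofNat s n : Fin s)) := measurable_from_top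
  refine Measurable.prodMk (h.comp (Measurable.nat_floor ?_)) (h.comp (Measurable.nat_floor ?_))
  · exact (Complex.measurable_re.div_const _).add_const _
  · exact (Complex.measurable_im.div_const _).add_const _

lemma floor_round {i : ℕ} {g x : ℝ} (hg : 0 < g) (hx : |x| < g / 2) :
    ⌊(g * i + x) / g + 1 / 2⌋₊ = i := by
  obtain ⟨h1, h2⟩ := abs_lt.1 hx
  have h3 : (g * i + x) / g + 1 / 2 = i + (x / g + 1 / 2) := by field_simp; ring
  have h4 : -(1 / 2) < x / g := by rw [lt_div_iff₀ hg]; linarith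
  have h5 : x / g < 1 / 2 := by rw [div_lt_iff₀ hg]; linarith
  rw [h3, Nat.floor_eq_iff (by have := (Nat.cast_nonneg i : (0 : ℝ) ≤ i); linarith)]
  constructor <;> linarith

/-- The gain `2 s g` turns the grid points `i / (2 s)` into multiples of `g`, and rounding then
removes noise smaller than `g / 2`. -/
lemma qamDemod_add {s g : ℕ} [NeZero s] (hg : 1 ≤ g) (x : Fin s × Fin s) {z : ℂ}
    (hz : ‖z‖ < (g : ℝ) / 2) :
    qamDemod s g (((2 * s * g : ℕ) : ℂ) * qamMod s x + z) = x := by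
  have hg' : (0 : ℝ) < g := by exact_mod_cast hg
  have hs' : (s : ℝ) ≠ 0 := by exact_mod_cast NeZero.ne s
  have hre : (((2 * s * g : ℕ) : ℂ) * qamMod s x + z).re = g * (x.1 : ℕ) + z.re := by
    rw [Complex.add_re, ← Complex.ofReal_natCast, Complex.re_ofReal_mul]
    simp only [qamMod]
    push_cast
    field_simp
  have him : (((2 * s * g : ℕ) : ℂ) * qamMod s x + z).im = g * (x.2 : ℕ) + z.im := by
    rw [Complex.add_im, ← Complex.ofReal_natCast, Complex.im_ofReal_mul]
    simp only [qamMod]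
    push_cast
    field_simp
  rw [qamDemod, hre, him, floor_round hg' ((Complex.abs_re_le_norm z).trans_lt hz),
    floor_round hg' ((Complex.abs_im_le_norm z).trans_lt hz)]
  ext <;> simp

/-! ### States in which the active links have the same gain -/

open LayeredNetwork

variable {K : ℕ} {ρ : Type*} [Fintype ρ] {net : LayeredNetwork K ρ}

open Classical in
variable (net) in
/-- The state in which the active links have gain `H` and the others have gain `0`. -/
noncomputable def onOffState (act : Node K ρ → Node K ρ → Prop) (H : ℂ) : net.Edge → ℂ :=
  fun e => if act e.1.1 e.1.2 then H else 0

variable {act : Node K ρ → Node K ρ → Prop} {H : ℂ}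

lemma recv_onOffState (z : ℕ × Node K ρ → ℂ) (t : ℕ) (X : Node K ρ → ℂ) (v : Node K ρ) :
    recv (onOffState net act H) z t X v = H * net.activeSum act X v + z (t, v) := by
  classical
  rw [recv, activeSum, Finset.mul_sum]
  congr 1
  refine Finset.sum_congr rfl fun e _ => ?_
  by_cases h : act e.1.1 e.1.2 <;> simp [onOffState, h]

lemma rate_eq_zero_of_silent {i : Fin K} (hi : ∀ v, ¬ act (.src i) v)
    {c : (N : ℕ) → NetCode K ρ ℂ N} {R : Fin K → ℝ}
    (h : Reliable (onOffState net act H) c R) : R i = 0 := by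
  obtain ⟨-, -, -, hR, herr⟩ := h
  refine rate_eq_zero (hR i) (herr i) fun N hN => ?_
  set s := onOffState net act H
  have hupd : ∀ z m k, (c N).decoded (recv s z) (Function.update m i k) i =
      (c N).decoded (recv s z) m i := fun z m k => by
    refine (c N).decoded_update (fun t X X' v hX => ?_) m k i
    rw [recv_onOffState, recv_onOffState]
    congr 2
    refine activeSum_congr fun u hu => hX u ?_
    rintro rfl
    exact hi v hu
  have key := messages_card_le_two_mul_sum hN
    (fun m => (noise K ρ).real {z | (c N).decoded (recv s z) m i ≠ m i}) ?_
  · have hpos : (0 : ℝ) < (messages N R).card := by exact_mod_cast messages_card_pos hR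
    rw [errorProb, le_div_iff₀ hpos]
    linarith
  · intro m k hk
    simp only [hupd, Function.update_self]
    refine le_trans ?_ (measureReal_union_le _ _)
    rw [← probReal_univ (μ := noise K ρ)]
    refine measureReal_mono fun z _ => ?_
    by_cases h1 : (c N).decoded (recv s z) m i = m i
    · right
      rw [Set.mem_ofPred_eq, h1]
      exact hk.symm
    · exact Or.inl h1

/-! ### Forwarding with quadrature amplitude modulation -/

section Achievability

variable {b : Fin K} {r : ℕ → Node K ρ}

lemma avgPower_le_one {h : net.Edge → ℂ} {N : ℕ} {c : NetCode K ρ ℂ N} {R : Fin K → ℝ}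
    {v : Node K ρ} (hc : ∀ z m t, ‖c.input (recv h z) m t v‖ ≤ 1) :
    avgPower h c R v ≤ 1 := by
  refine ENNReal.div_le_of_le_mul ?_
  rw [one_mul]
  calc _ ≤ ∑ m ∈ messages N R, ∫⁻ _, (N : ℝ≥0∞) ∂(noise K ρ) := by
        refine Finset.sum_le_sum fun m _ => lintegral_mono fun z => ?_
        calc _ ≤ ∑ t ∈ Finset.range N, (1 : ℝ≥0∞) := by
              refine Finset.sum_le_sum fun t _ => ?_
              refine pow_le_one' ?_ 2
              rw [← ofReal_norm]
              exact ENNReal.ofReal_le_one.2 (hc z m t)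
          _ = N := by simp
    _ = N * (messages N R).card := by
      simp [mul_comm]

open Classical in
/-- The number of symbols delivered wrongly is at most the number of large noise values. -/
lemma hammingDist_routeCode_le (hadj : ∀ u v, act u v → net.Adj u v) (hr : net.IsPath b b r)
    (hroute : ∀ l, 1 ≤ l → l < net.L → act (r l) (r (l + 1))) {s g : ℕ} [NeZero s] (hg : 1 ≤ g)
    {C : ℕ → ℕ → Fin s × Fin s} {N : ℕ} {Dec : (Fin (N - (net.L - 2)) → Fin s × Fin s) → ℕ}
    (m : Fin K → ℕ) (z : ℕ × Node K ρ → ℂ) :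
    hammingDist (fun k : Fin (N - (net.L - 2)) => qamDemod s g
      ((routeCode net b r (qamMod s) (qamDemod s g) C N Dec).received
        (recv (onOffState net act ((2 * s * g : ℕ) : ℂ)) z) m N (.dst b)
        ⟨k + (net.L - 2), by omega⟩)) (fun k => C (m b) k) ≤
      ((Finset.range N ×ˢ Finset.univ).filter fun i => (g : ℝ) / 2 ≤ ‖z i‖).card := by
  have hbad : ∀ k : Fin (N - (net.L - 2)), qamDemod s g
      ((routeCode net b r (qamMod s) (qamDemod s g) C N Dec).received
        (recv (onOffState net act ((2 * s * g : ℕ) : ℂ)) z) m N (.dst b)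
        ⟨k + (net.L - 2), by omega⟩) ≠ C (m b) k →
      ∃ j, j + 2 ≤ net.L ∧ (g : ℝ) / 2 ≤ ‖z (k + j, r (j + 2))‖ := by
    intro k hk
    by_contra hcon
    push Not at hcon
    refine hk (routeCode_demod_received hr ?_ (by omega))
    intro j hj X hX hXr
    rw [recv_onOffState, activeSum_eq_single hadj (hroute (j + 1) (by omega) hj), hXr]
    · exact qamDemod_add hg _ (hcon j hj)
    · intro u hu hne
      refine hX u ?_ hne
      have h1 := layer_of_adj (hadj _ _ hu)
      rw [hr.layer (by omega) (by omega)] at h1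
      omega
  choose! j hj1 hj2 using hbad
  -- Each wrong symbol is charged to a large noise value at one of its hops. The layer of the node
  -- recovers the hop, and the time then recovers the symbol, so no noise value is charged twice.
  refine Finset.card_le_card_of_injOn
    (fun k => ((k : ℕ) + j k, r (j k + 2))) ?_ ?_
  · intro k hk
    simp only [Finset.coe_filter, Finset.mem_univ, true_and, Set.mem_ofPred_eq] at hk
    have h1 := hj1 k hk
    simp only [Finset.coe_filter, Finset.mem_product, Finset.mem_range, Finset.mem_univ, and_true,
      Set.mem_ofPred_eq]
    exact ⟨by omega, hj2 k hk⟩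
  · intro k hk k' hk' heq
    simp only [Finset.coe_filter, Finset.mem_univ, true_and, Set.mem_ofPred_eq] at hk hk'
    simp only [Prod.mk.injEq] at heq
    have h1 := hr.layer (l := j k + 2) (by omega) (hj1 k hk)
    rw [heq.2, hr.layer (by omega) (hj1 k' hk')] at h1
    exact Fin.ext (by omega)

/-- A code correcting `N / d` errors is concatenated with hop-by-hop rounding. With `V` nodes, more
than `N / d` large noise values among `N V` have probability at most `2 ^ (N V) * 2 ^ (-N (V + 1)) =
2 ^ (-N)`, which is why the tail bound has exponent `d (V + 1)`. -/
lemma le_sumCapacity_of_route (hadj : ∀ u v, act u v → net.Adj u v) (hr : net.IsPath b b r)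
    (hroute : ∀ l, 1 ≤ l → l < net.L → act (r l) (r (l + 1))) {d k g : ℕ} (hd : 4 ≤ d)
    (hk : 2 ≤ k) (hg : 1 ≤ g)
    (htail : complexGaussian.real {z | (g : ℝ) / 2 ≤ ‖z‖} ≤
      (1 / 2) ^ (d * (Fintype.card (Node K ρ) + 1))) :
    ((2 * k * (1 - 2 / d) - 2 : ℝ) : EReal) ≤
      sumCapacity (Reliable (onOffState net act ((2 * 2 ^ k * g : ℕ) : ℂ))) := by
  classical
  have : NeZero (2 ^ k) := ⟨by positivity⟩
  set x : ℝ := 2 * k * (1 - 2 / d) - 2 with hxdef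
  have hd' : (4 : ℝ) ≤ d := by exact_mod_cast hd
  have hk' : (2 : ℝ) ≤ k := by exact_mod_cast hk
  have hx : 0 ≤ x := by
    have h1 : (2 : ℝ) / d ≤ 1 / 2 := by rw [div_le_iff₀ (by linarith)]; linarith
    nlinarith
  let R : Fin K → ℝ := fun i => if i = b then x else 0
  let n : ℕ → ℕ := fun N => N - (net.L - 2)
  have hcode : ∀ N : ℕ, ∃ (C : ℕ → Fin (n N) → Fin (2 ^ k) × Fin (2 ^ k))
      (D : (Fin (n N) → Fin (2 ^ k) × Fin (2 ^ k)) → ℕ), 2 * k * (net.L - 2) ≤ N →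
      ∀ m < ⌊(2 : ℝ) ^ (N * x)⌋₊, ∀ w, hammingDist w (C m) ≤ N / d → D w = m := by
    intro N
    by_cases hN : 2 * k * (net.L - 2) ≤ N
    · have hcount : ⌊(2 : ℝ) ^ (N * x)⌋₊ * (2 ^ n N *
          Fintype.card (Fin (2 ^ k) × Fin (2 ^ k)) ^ (2 * (N / d))) ≤
          Fintype.card (Fin (2 ^ k) × Fin (2 ^ k)) ^ n N := by
        rw [Fintype.card_prod, Fintype.card_fin, ← Nat.cast_le (α := ℝ)]
        have hfl : ((⌊(2 : ℝ) ^ (N * x)⌋₊ : ℕ) : ℝ) ≤ 2 ^ (N * x) := Nat.floor_le (by positivity)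
        have hpow : ∀ l : ℕ, (((2 ^ k * 2 ^ k) ^ l : ℕ) : ℝ) = 2 ^ (2 * k * l : ℝ) := by
          intro l
          rw [← pow_add, ← pow_mul, Nat.cast_pow, ← Real.rpow_natCast]
          push_cast
          rw [two_mul (k : ℝ)]
        rw [Nat.cast_mul, Nat.cast_mul, hpow, hpow]
        refine (mul_le_mul_of_nonneg_right hfl (by positivity)).trans ?_
        rw [Nat.cast_pow, ← Real.rpow_natCast, Nat.cast_two, ← Real.rpow_add two_pos,
          ← Real.rpow_add two_pos]
        refine Real.rpow_le_rpow_of_exponent_le one_le_two ?_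
        have he : ((N / d : ℕ) : ℝ) ≤ N / d := Nat.cast_div_le
        have hLN : net.L - 2 ≤ N := by
          refine le_trans ?_ hN
          exact Nat.le_mul_of_pos_left _ (by omega)
        have hn : ((n N : ℕ) : ℝ) = N - (net.L - 2 : ℕ) := by
          simp only [n]; rw [Nat.cast_sub hLN]
        have hN' : (2 * k * (net.L - 2 : ℕ) : ℝ) ≤ N := by exact_mod_cast hN
        have h0 : (0 : ℝ) ≤ (net.L - 2 : ℕ) := Nat.cast_nonneg _
        rw [hn, hxdef]
        push_cast
        -- The Hamming balls cost `4 k N / d` bits. The summand `-2` in the rate pays for the factor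
        -- `2 ^ n` of the ball bound and for the `2 k (L - 2)` bits lost to the delay, each at most
        -- `N` bits.
        have h2 : (N : ℝ) * (2 * k * (1 - 2 / d) - 2) = 2 * k * N - 4 * k * (N / d) - 2 * N := by
          ring
        rw [h2]
        nlinarith
      obtain ⟨C, D, h⟩ := exists_code_decoder _ _ hcount
      exact ⟨C, D, fun _ => h⟩
    · exact ⟨fun _ _ => 0, fun _ => 0, fun h => absurd h hN⟩
  choose C D hCD using hcode
  let C' : ℕ → ℕ → ℕ → Fin (2 ^ k) × Fin (2 ^ k) := fun N m t =>
    if h : t < n N then C N m ⟨t, h⟩ else 0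
  let c : (N : ℕ) → NetCode K ρ ℂ N := fun N =>
    routeCode net b r (qamMod (2 ^ k)) (qamDemod (2 ^ k) g) (C' N) N (D N)
  set st := onOffState net act ((2 * 2 ^ k * g : ℕ) : ℂ)
  have hR : ∀ i, 0 ≤ R i := by
    intro i
    simp only [R]
    split_ifs
    exacts [hx, le_rfl]
  refine le_sSup ⟨c, R, ⟨?_, ?_, ?_, hR, ?_⟩, by simp [R]⟩
  · intro N q t
    simp only [c, routeCode]
    by_cases h : (∃ l, 1 ≤ l ∧ l ≤ net.L ∧ r l = .relay q) ∧ 0 < t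
    · simp only [h, and_self, dite_true]
      exact (Measurable.of_discrete (f := qamMod (2 ^ k))).comp
        ((measurable_qamDemod _ _).comp (measurable_pi_apply _))
    · simp only [h, dite_false]
      exact measurable_const
  · intro N i
    simp only [c, routeCode]
    split_ifs
    · refine (Measurable.of_discrete (f := D N)).comp (measurable_pi_lambda _ fun k => ?_)
      exact (measurable_qamDemod _ _).comp (measurable_pi_apply _)
    · exact measurable_const
  · intro v
    refine limsup_le_of_le (h := Eventually.of_forall fun N => avgPower_le_one fun z m t => ?_)
    rcases routeCode_input_mem (net := net) (b := b) (r := r) (mod := qamMod (2 ^ k))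
      (demod := qamDemod (2 ^ k) g) (C := C' N) (N := N) (Dec := D N) (recv := recv st z) (m := m)
      t v with h | ⟨y, h⟩
    · simp only [c, h, norm_zero, zero_le_one]
    · simp only [c, h]
      exact norm_qamMod_le y
  · intro i
    have hlim : Tendsto (fun N : ℕ => ((1 : ℝ) / 2) ^ N) atTop (𝓝 0) :=
      tendsto_pow_atTop_nhds_zero_of_lt_one (by norm_num) (by norm_num)
    refine squeeze_zero' (Eventually.of_forall fun N => by unfold errorProb; positivity) ?_ hlim
    filter_upwards [eventually_ge_atTop (2 * k * (net.L - 2))] with N hN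
    have hpos : (0 : ℝ) < (messages N R).card := by exact_mod_cast messages_card_pos hR
    rw [errorProb, div_le_iff₀ hpos]
    have hm : ∀ m ∈ messages N R, (noise K ρ).real {z | (c N).decoded (recv st z) m i ≠ m i} ≤
        (1 / 2) ^ N := by
      intro m hm
      by_cases hi : i = b
      · subst hi
        have hlt := mem_messages.1 hm i
        simp only [R, if_true] at hlt
        have hsub : {z | (c N).decoded (recv st z) m i ≠ m i} ⊆
            {z | N / d < ((Finset.range N ×ˢ (Finset.univ : Finset (Node K ρ))).filter
              fun i => (g : ℝ) / 2 ≤ ‖z i‖).card} := by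
          intro z hz
          rw [Set.mem_ofPred_eq] at hz ⊢
          by_contra hle
          refine hz ?_
          change (if i = i then _ else 0) = m i
          rw [if_pos rfl]
          refine hCD N hN (m i) hlt _ (le_trans ?_ (not_lt.1 hle))
          have h1 := hammingDist_routeCode_le hadj hr hroute hg (C := C' N) (N := N)
            (Dec := D N) m z
          have h2 : (fun t : Fin (n N) => C' N (m i) t) = C N (m i) := by
            funext t
            simp [C']
          rw [h2] at h1
          exact h1
        have hp0 : 0 ≤ complexGaussian.real {z | (g : ℝ) / 2 ≤ ‖z‖} := measureReal_nonneg
        calc _ ≤ _ := measureReal_mono hsub (measure_ne_top _ _)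
          _ ≤ _ := noise_real_card_lt_le _ _ _
          _ ≤ 2 ^ (N * Fintype.card (Node K ρ)) *
              ((1 / 2) ^ (d * (Fintype.card (Node K ρ) + 1))) ^ (N / d + 1) := by
            rw [Finset.card_product, Finset.card_range, Finset.card_univ]
            gcongr
          _ ≤ 2 ^ (N * Fintype.card (Node K ρ)) *
              (1 / 2) ^ (N * (Fintype.card (Node K ρ) + 1)) := by
            rw [← pow_mul]
            refine mul_le_mul_of_nonneg_left (pow_le_pow_of_le_one (by norm_num) (by norm_num) ?_)
              (by positivity)
            have : N ≤ d * (N / d + 1) := by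
              have := Nat.lt_mul_div_succ N (show 0 < d by omega)
              exact this.le
            calc N * (Fintype.card (Node K ρ) + 1)
                ≤ (d * (N / d + 1)) * (Fintype.card (Node K ρ) + 1) := Nat.mul_le_mul_right _ this
              _ = _ := by ring
          _ = (1 / 2) ^ N := by
            rw [Nat.mul_add, mul_one, pow_add, ← mul_assoc, ← mul_pow]
            norm_num
      · have hm0 : m i = 0 := messages_apply_of_rate_zero hm (by simp [R, hi])
        have : {z | (c N).decoded (recv st z) m i ≠ m i} = ∅ := by
          refine Set.eq_empty_iff_forall_notMem.2 fun z hz => hz ?_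
          rw [hm0]
          change (if i = b then _ else 0) = 0
          rw [if_neg hi]
        rw [this, measureReal_empty]
        positivity
    refine (Finset.sum_le_card_nsmul _ _ _ hm).trans ?_
    rw [nsmul_eq_mul, mul_comm]

end Achievability

end Gauss

namespace Gauss

/-! ### Shifted Gaussian laws are dominated by a wider Gaussian law -/

/-- Completing the square: the exponent of the right side minus that of the left is `(c - S (x - c))
^ 2 / (S (1 + S))`. The factor `√(1 + S)` compensates the normalizations; two real components give
`1 + S`. -/
lemma gaussianReal_le_smul (c : ℝ) {S : ℝ} (hS : 0 < S) :
    gaussianReal c (1 / 2) ≤ ENNReal.ofReal (√(1 + S) * Real.exp (c ^ 2 / S)) •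
      gaussianReal 0 ((1 + S) / 2).toNNReal := by
  have hv : ((1 + S) / 2).toNNReal ≠ 0 := by
    rw [ne_eq, Real.toNNReal_eq_zero, not_le]; positivity
  rw [gaussianReal_of_var_ne_zero c (by norm_num), gaussianReal_of_var_ne_zero 0 hv,
    ← withDensity_smul _ (measurable_gaussianPDF _ _)]
  refine withDensity_mono (Eventually.of_forall fun x => ?_)
  simp only [Pi.smul_apply, smul_eq_mul, gaussianPDF]
  rw [← ENNReal.ofReal_mul (by positivity)]
  refine ENNReal.ofReal_le_ofReal ?_
  simp only [gaussianPDFReal]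
  rw [Real.coe_toNNReal _ (by positivity)]
  have h1 : 2 * Real.pi * ((1 + S) / 2) = Real.pi * (1 + S) := by ring
  have h2 : (2 * Real.pi * ((1 / 2 : NNReal) : ℝ)) = Real.pi := by push_cast; ring
  have h3 : (2 * ((1 / 2 : NNReal) : ℝ)) = 1 := by push_cast; ring
  rw [h1, h2, h3, Real.sqrt_mul Real.pi_pos.le, mul_inv]
  have hs : 0 < √(1 + S) := Real.sqrt_pos.2 (by linarith)
  have h4 : √(1 + S) * Real.exp (c ^ 2 / S) * ((√Real.pi)⁻¹ * (√(1 + S))⁻¹ *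
      Real.exp (-(x - 0) ^ 2 / (2 * ((1 + S) / 2)))) =
      (√Real.pi)⁻¹ * Real.exp (c ^ 2 / S + -(x - 0) ^ 2 / (2 * ((1 + S) / 2))) := by
    rw [Real.exp_add]; field_simp
  rw [h4]
  refine mul_le_mul_of_nonneg_left (Real.exp_le_exp.2 ?_) (by positivity)
  have h5 : c ^ 2 / S + -(x - 0) ^ 2 / (2 * ((1 + S) / 2)) - -(x - c) ^ 2 / 1 =
      (c - S * (x - c)) ^ 2 / (S * (1 + S)) := by
    field_simp; ring
  have h6 : 0 ≤ (c - S * (x - c)) ^ 2 / (S * (1 + S)) := by positivity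
  linarith

/-- The circularly symmetric complex Gaussian law of variance `1 + S`. -/
noncomputable def wideGaussian (S : ℝ) : Measure ℂ :=
  ((gaussianReal 0 ((1 + S) / 2).toNNReal).prod (gaussianReal 0 ((1 + S) / 2).toNNReal)).map
    fun p => (⟨p.1, p.2⟩ : ℂ)

lemma measurable_complex_mk : Measurable fun p : ℝ × ℝ => (⟨p.1, p.2⟩ : ℂ) :=
  Complex.measurableEquivRealProd.symm.measurable

instance (S : ℝ) : IsProbabilityMeasure (wideGaussian S) :=
  Measure.isProbabilityMeasure_map measurable_complex_mk.aemeasurable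

lemma map_add_complexGaussian_le (c : ℂ) {S : ℝ} (hS : 0 < S) :
    complexGaussian.map (c + ·) ≤
      ENNReal.ofReal ((1 + S) * Real.exp (‖c‖ ^ 2 / S)) • wideGaussian S := by
  have h1 : complexGaussian.map (c + ·) =
      ((gaussianReal c.re (1 / 2)).prod (gaussianReal c.im (1 / 2))).map
        fun p => (⟨p.1, p.2⟩ : ℂ) := by
    have hre := gaussianReal_map_const_add (μ := 0) (v := 1 / 2) c.re
    have him := gaussianReal_map_const_add (μ := 0) (v := 1 / 2) c.im
    rw [zero_add] at hre him
    rw [← hre, ← him, Measure.map_prod_map _ _ (by fun_prop) (by fun_prop), complexGaussian,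
      Measure.map_map (by fun_prop) measurable_complex_mk,
      Measure.map_map measurable_complex_mk (by fun_prop)]
    congr 1
  have h2 : (gaussianReal c.re (1 / 2)).prod (gaussianReal c.im (1 / 2)) ≤
      ENNReal.ofReal ((1 + S) * Real.exp (‖c‖ ^ 2 / S)) •
        (gaussianReal 0 ((1 + S) / 2).toNNReal).prod
          (gaussianReal 0 ((1 + S) / 2).toNNReal) := by
    refine (Measure.prod_mono (gaussianReal_le_smul c.re hS)
      (gaussianReal_le_smul c.im hS)).trans (le_of_eq ?_)
    rw [Measure.prod_smul_left, Measure.prod_smul_right, smul_smul, ← ENNReal.ofReal_mul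
      (by positivity)]
    congr 2
    have h3 : ‖c‖ ^ 2 = c.re ^ 2 + c.im ^ 2 := by
      rw [← Complex.normSq_eq_norm_sq, Complex.normSq_apply]; ring
    rw [h3, add_div, Real.exp_add]
    have h4 := Real.mul_self_sqrt (show 0 ≤ 1 + S by linarith)
    linear_combination Real.exp (c.re ^ 2 / S) * Real.exp (c.im ^ 2 / S) * h4
  rw [h1, wideGaussian, ← Measure.map_smul]
  exact Measure.map_mono h2 measurable_complex_mk

lemma pi_le_smul_pi {X : Type*} [MeasurableSpace X] (ν : Measure X) [IsFiniteMeasure ν] :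
    ∀ {N : ℕ} (μ : Fin N → Measure X) [∀ i, SigmaFinite (μ i)] (k : Fin N → ℝ≥0∞),
      (∀ i, k i ≠ ∞) → (∀ i, μ i ≤ k i • ν) →
      Measure.pi μ ≤ (∏ i, k i) • Measure.pi fun _ => ν := by
  intro N
  induction N with
  | zero =>
    intro μ _ k _ _
    obtain rfl : μ = fun _ => ν := Subsingleton.elim _ _
    simp
  | succ N ih =>
    intro μ _ k hk hle
    have h1 := (measurePreserving_piFinSuccAbove μ 0).symm
    have h2 := (measurePreserving_piFinSuccAbove (fun _ : Fin (N + 1) => ν) 0).symm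
    have hfin : IsFiniteMeasure (k 0 • ν) := ν.smul_finite (hk 0)
    rw [← h1.map_eq, ← h2.map_eq, ← Measure.map_smul]
    refine Measure.map_mono ?_ (MeasurableEquiv.measurable _)
    have h3 := ih (fun j => μ (Fin.succAbove 0 j)) (fun j => k (Fin.succAbove 0 j))
      (fun j => hk _) (fun j => hle _)
    refine le_trans (Measure.prod_mono (hle 0) le_rfl) ?_
    rw [Measure.prod_smul_left, Fin.prod_univ_succAbove _ 0, ← smul_smul]
    refine Measure.le_iff'.2 fun s => ?_
    rw [Measure.smul_apply, Measure.smul_apply, smul_eq_mul, smul_eq_mul]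
    refine mul_le_mul_right ?_ _
    rw [← Measure.prod_smul_right]
    exact (Measure.prod_mono le_rfl h3) s

lemma map_add_pi_complexGaussian_le {N : ℕ} (c : Fin N → ℂ) {S : ℝ} (hS : 0 < S) :
    (Measure.pi fun _ : Fin N => complexGaussian).map (c + ·) ≤
      ENNReal.ofReal ((1 + S) ^ N * Real.exp ((∑ t, ‖c t‖ ^ 2) / S)) •
        Measure.pi fun _ => wideGaussian S := by
  have hprob : ∀ t, IsProbabilityMeasure (complexGaussian.map (c t + ·)) := fun t =>
    Measure.isProbabilityMeasure_map (by fun_prop)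
  have h1 : (Measure.pi fun _ : Fin N => complexGaussian).map (c + ·) =
      Measure.pi fun t => complexGaussian.map (c t + ·) :=
    (Measure.pi_map_pi (μ := fun _ : Fin N => complexGaussian) (f := fun t => (c t + ·))
      (fun t => by fun_prop)).symm ▸ rfl
  rw [h1]
  refine (pi_le_smul_pi (wideGaussian S) _ _ (fun _ => ENNReal.ofReal_ne_top)
    (fun t => map_add_complexGaussian_le (c t) hS)).trans (le_of_eq ?_)
  congr 1
  rw [← ENNReal.ofReal_prod_of_nonneg (fun _ _ => by positivity), Finset.prod_mul_distrib,
    Finset.prod_const, Finset.card_univ, Fintype.card_fin, ← Real.exp_sum, Finset.sum_div]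

/-- Decoding over additive white Gaussian noise: the probabilities of correct decoding of all
codewords of power at most `P` add up to at most `(1 + S) ^ N * exp (P / S)`. -/
lemma sum_measure_decoded_le {ι : Type*} {N : ℕ} (F : Finset ι) (c : ι → Fin N → ℂ)
    (D : ι → Set (Fin N → ℂ)) (hD : ∀ i ∈ F, MeasurableSet (D i))
    (hdisj : Set.PairwiseDisjoint (F : Set ι) D) {S P : ℝ} (hS : 0 < S)
    (hP : ∀ i ∈ F, ∑ t, ‖c i t‖ ^ 2 ≤ P) :
    ∑ i ∈ F, (Measure.pi fun _ : Fin N => complexGaussian) ((c i + ·) ⁻¹' D i) ≤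
      ENNReal.ofReal ((1 + S) ^ N * Real.exp (P / S)) := by
  calc _ ≤ ∑ i ∈ F, ENNReal.ofReal ((1 + S) ^ N * Real.exp (P / S)) *
        (Measure.pi fun _ : Fin N => wideGaussian S) (D i) := by
        refine Finset.sum_le_sum fun i hi => ?_
        rw [← Measure.map_apply (by fun_prop) (hD i hi)]
        refine (map_add_pi_complexGaussian_le (c i) hS (D i)).trans ?_
        rw [Measure.smul_apply, smul_eq_mul]
        refine mul_le_mul_left (ENNReal.ofReal_le_ofReal ?_) _
        refine mul_le_mul_of_nonneg_left (Real.exp_le_exp.2 ?_) (by positivity)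
        exact div_le_div_of_nonneg_right (hP i hi) hS.le
    -- Every codeword is now measured by the same probability law, so the disjoint decoding sets
    -- have total mass at most `1`.
    _ = ENNReal.ofReal ((1 + S) ^ N * Real.exp (P / S)) *
        (Measure.pi fun _ : Fin N => wideGaussian S) (⋃ i ∈ F, D i) := by
        rw [← Finset.mul_sum, measure_biUnion_finset hdisj hD]
    _ ≤ _ := by
        refine (mul_le_mul_right prob_le_one _).trans ?_
        rw [mul_one]

/-! ### Resampling the noise at one node -/

variable {K : ℕ} {ρ : Type*}

open Classical in
/-- The noise `z` with the first `N` values at the node `x` replaced by `y`. -/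
noncomputable def inject {N : ℕ} (x : Node K ρ) (y : Fin N → ℂ) (z : ℕ × Node K ρ → ℂ) :
    ℕ × Node K ρ → ℂ :=
  fun i => if h : i.2 = x ∧ i.1 < N then y ⟨i.1, h.2⟩ else z i

lemma inject_of_ne {N : ℕ} {x v : Node K ρ} (hv : v ≠ x) (y : Fin N → ℂ)
    (z : ℕ × Node K ρ → ℂ) (t : ℕ) : inject x y z (t, v) = z (t, v) := by
  simp [inject, hv]

lemma inject_self {N : ℕ} (x : Node K ρ) (y : Fin N → ℂ) (z : ℕ × Node K ρ → ℂ) {t : ℕ}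
    (ht : t < N) : inject x y z (t, x) = y ⟨t, ht⟩ := by
  simp [inject, ht]

lemma measurable_inject {N : ℕ} (x : Node K ρ) :
    Measurable fun p : (Fin N → ℂ) × (ℕ × Node K ρ → ℂ) => inject x p.1 p.2 := by
  refine measurable_pi_lambda _ fun i => ?_
  by_cases h : i.2 = x ∧ i.1 < N
  · simp only [inject, h, and_self, dite_true]
    fun_prop
  · simp only [inject, h, dite_false]
    fun_prop

/-- All noise values are independent with the same law, so fresh values at finitely many places
leave the law unchanged. It suffices to check this on finite cylinders. -/
lemma measurePreserving_inject (N : ℕ) (x : Node K ρ) :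
    MeasurePreserving (fun p : (Fin N → ℂ) × (ℕ × Node K ρ → ℂ) => inject x p.1 p.2)
      ((Measure.pi fun _ => complexGaussian).prod (noise K ρ)) (noise K ρ) := by
  classical
  refine ⟨measurable_inject x, ?_⟩
  refine Measure.eq_infinitePi (fun _ => complexGaussian) fun s t ht => ?_
  let sp : ℕ × Node K ρ → Prop := fun i => i.2 = x ∧ i.1 < N
  have hpre : (fun p : (Fin N → ℂ) × (ℕ × Node K ρ → ℂ) => inject x p.1 p.2) ⁻¹'
      (Set.pi s t) =
      (Set.pi Set.univ fun k : Fin N => if ((k : ℕ), x) ∈ s then t (k, x) else Set.univ) ×ˢ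
        (Set.pi (s.filter fun i => ¬ sp i : Finset _) t) := by
    ext ⟨y, z⟩
    simp only [Set.mem_preimage, Set.mem_pi, Finset.mem_coe, Set.mem_prod, Finset.mem_filter,
      Set.mem_univ, true_implies]
    constructor
    · intro h
      refine ⟨fun k => ?_, fun i hi => ?_⟩
      · split_ifs with hk
        · have := h _ hk
          rwa [inject_self x y z k.2] at this
        · trivial
      · have := h i hi.1
        rwa [inject, dif_neg hi.2] at this
    · rintro ⟨h1, h2⟩ i hi
      by_cases hsp : sp i
      · obtain ⟨j, v⟩ := i
        obtain ⟨rfl, hj⟩ := hsp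
        rw [inject_self _ y z hj]
        have := h1 ⟨j, hj⟩
        rwa [if_pos hi] at this
      · rw [inject, dif_neg hsp]
        exact h2 i ⟨hi, hsp⟩
  rw [Measure.map_apply (measurable_inject x)
    (MeasurableSet.pi s.countable_toSet fun i _ => ht i), hpre, Measure.prod_prod,
    Measure.pi_pi, noise, Measure.infinitePi_pi _ (fun i _ => ht i),
    ← Finset.prod_filter_mul_prod_filter_not s sp]
  congr 1
  have h1 : ∀ k : Fin N, complexGaussian (if ((k : ℕ), x) ∈ s then t (k, x) else Set.univ) =
      if ((k : ℕ), x) ∈ s then complexGaussian (t (k, x)) else 1 := by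
    intro k
    split_ifs <;> simp
  simp only [h1]
  rw [← Finset.prod_filter]
  refine Finset.prod_bij (fun k _ => ((k : ℕ), x)) ?_ ?_ ?_ (fun _ _ => rfl)
  · intro k hk
    simp only [Finset.mem_filter, Finset.mem_univ, true_and] at hk ⊢
    exact ⟨hk, rfl, k.2⟩
  · intro k _ k' _ h
    exact Fin.ext (Prod.mk.inj h).1
  · rintro ⟨j, v⟩ hi
    simp only [Finset.mem_filter] at hi
    obtain ⟨hi, rfl, hj⟩ := hi
    exact ⟨⟨j, hj⟩, by simpa using hi, rfl⟩

end Gauss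

/-! ### Measurability of the signals in a run of a code -/

namespace NetCode

variable {K : ℕ} {ρ : Type*} {N : ℕ} {c : NetCode K ρ ℂ N} {Ω : Type*} [MeasurableSpace Ω]
  {recv : Ω → ℕ → (Node K ρ → ℂ) → Node K ρ → ℂ}

lemma measurable_input (hc : ∀ r t, Measurable (c.relay r t))
    (hrecv : ∀ t v (X : Ω → Node K ρ → ℂ), (∀ u, Measurable fun ω => X ω u) →
      Measurable fun ω => recv ω t (X ω) v) (m : Fin K → ℕ) (t : ℕ) (v : Node K ρ) :
    (Measurable fun ω => c.received (recv ω) m t v) ∧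
      Measurable fun ω => c.input (recv ω) m t v := by
  induction t using Nat.strong_induction_on generalizing v with
  | _ t ih =>
    have h : Measurable fun ω => c.received (recv ω) m t v := by
      refine measurable_pi_lambda _ fun k => ?_
      simp only [received_apply]
      exact hrecv k v _ fun u => (ih k k.2 u).2
    refine ⟨h, ?_⟩
    cases v with
    | src i => exact measurable_const
    | relay r => exact (hc r t).comp h
    | dst i => exact measurable_const

lemma measurable_decoded (hc : ∀ r t, Measurable (c.relay r t))
    (hd : ∀ i, Measurable (c.dec i))
    (hrecv : ∀ t v (X : Ω → Node K ρ → ℂ), (∀ u, Measurable fun ω => X ω u) →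
      Measurable fun ω => recv ω t (X ω) v) (m : Fin K → ℕ) (i : Fin K) :
    Measurable fun ω => c.decoded (recv ω) m i :=
  (hd i).comp (measurable_input hc hrecv m N (.dst i)).1

end NetCode

/-! ### Gaussian converse -/

namespace Gauss

open LayeredNetwork

variable {K : ℕ} {ρ : Type*} [Fintype ρ] {net : LayeredNetwork K ρ} {a b : Fin K} {H : ℂ} {N : ℕ}

lemma measurable_recv {Ω : Type*} [MeasurableSpace Ω] (h : net.Edge → ℂ)
    {z : Ω → ℕ × Node K ρ → ℂ} (hz : Measurable z) (t : ℕ) (v : Node K ρ)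
    {X : Ω → Node K ρ → ℂ} (hX : ∀ u, Measurable fun ω => X ω u) :
    Measurable fun ω => recv h (z ω) t (X ω) v := by
  classical
  unfold recv
  refine Measurable.add (Finset.measurable_sum _ fun e _ => (hX _).const_mul _) ?_
  exact (measurable_pi_apply _).comp hz

open Classical in
/-- Reception in the state `h` with noise `z`, except that the node `x` receives `Y`. -/
noncomputable def forcedRecv (h : net.Edge → ℂ) (z : ℕ × Node K ρ → ℂ) (x : Node K ρ)
    (Y : Fin N → ℂ) (t : ℕ) (X : Node K ρ → ℂ) (v : Node K ρ) : ℂ :=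
  if hv : v = x ∧ t < N then Y ⟨t, hv.2⟩ else recv h z t X v

lemma measurable_decoded_forcedRecv {c : NetCode K ρ ℂ N}
    (hrelay : ∀ r t, Measurable (c.relay r t)) (hdec : ∀ i, Measurable (c.dec i))
    (h : net.Edge → ℂ) (z : ℕ × Node K ρ → ℂ) (x : Node K ρ) (m : Fin K → ℕ) (i : Fin K) :
    Measurable fun Y : Fin N → ℂ => c.decoded (forcedRecv h z x Y) m i := by
  refine NetCode.measurable_decoded hrelay hdec (fun t v X hX => ?_) m i
  by_cases hv : v = x ∧ t < N
  · simp only [forcedRecv, hv, and_self, dite_true]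
    exact measurable_pi_apply _
  · simp only [forcedRecv, hv, dite_false]
    exact measurable_recv h measurable_const t v hX

variable (M : net.MeetingFlows a b) (c : NetCode K ρ ℂ N)

/-- The inputs of a node in a set that is closed under active links do not depend on the noise
outside that set. -/
lemma input_eq_of_closed {act : Node K ρ → Node K ρ → Prop} {S : Set (Node K ρ)}
    (hS : ∀ u v, act u v → v ∈ S → u ∈ S) {z z' : ℕ × Node K ρ → ℂ}
    (hz : ∀ t, ∀ v ∈ S, z (t, v) = z' (t, v)) {m m' : Fin K → ℕ}
    (hm : ∀ i, .src i ∈ S → m i = m' i) (t : ℕ) {u : Node K ρ} (hu : u ∈ S) :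
    c.input (recv (onOffState net act H) z) m t u =
      c.input (recv (onOffState net act H) z') m' t u := by
  refine (c.received_congr S (T := t) hm ?_ t le_rfl u hu).2
  intro t _ hX v hv
  rw [recv_onOffState, recv_onOffState, hz t v hv]
  congr 2
  exact activeSum_congr fun w hw => hX w (hS w v hw hv)

/-- A destination that is fed through the node `x` alone decodes a function of what `x` receives
and of the noise elsewhere. -/
lemma decoded_inject_eq {act : Node K ρ → Node K ρ → Prop} {x : Node K ρ} {T : Set (Node K ρ)}
    (hT : ∀ u v, act u v → v ∈ T → v ≠ x → u ∈ T) (hsrc : ∀ i, .src i ∉ T) {i : Fin K}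
    (hi : .dst i ∈ T) (m : Fin K → ℕ) (y : Fin N → ℂ) (z : ℕ × Node K ρ → ℂ) (Y : Fin N → ℂ)
    (hY : ∀ t : Fin N, Y t = H * net.activeSum act
      (c.input (recv (onOffState net act H) (inject x y z)) m t) x + y t) :
    c.decoded (recv (onOffState net act H) (inject x y z)) m i =
      c.decoded (forcedRecv (onOffState net act H) z x Y) 0 i := by
  refine congrArg (c.dec i) (c.received_congr T (T := N) (fun i hi => absurd hi (hsrc i)) ?_ N le_rfl
    _ hi).1
  intro t ht hX v hv
  by_cases hvx : v = x
  · subst hvx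
    rw [forcedRecv, dif_pos ⟨rfl, ht⟩, hY ⟨t, ht⟩, recv_onOffState, inject_self _ _ _ ht]
  · rw [forcedRecv, dif_neg (fun h => hvx h.1), recv_onOffState, recv_onOffState,
      inject_of_ne hvx]
    congr 2
    exact activeSum_congr fun w hw => hX w (hT w v hw hv hvx)

/-- What `x` hears of the codewords, without noise at `x`. -/
noncomputable def codeword (H : ℂ) (z : ℕ × Node K ρ → ℂ) (m : Fin K → ℕ) (t : Fin N) : ℂ :=
  H * (c.input (recv (onOffState net M.Active H) z) m t M.p +
    c.input (recv (onOffState net M.Active H) z) m t M.f)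

open Classical in
/-- The signals received by `x` from which both messages are decoded as `m`, when `D_a` is fed with
the same noise as `x`. -/
def decodingSet (H : ℂ) (z : ℕ × Node K ρ → ℂ) (m : Fin K → ℕ) : Set (Fin N → ℂ) :=
  {Y | c.decoded (forcedRecv (onOffState net M.Active H) z M.x Y) 0 b = m b ∧
    c.decoded (forcedRecv (onOffState net M.Active H) z M.κ (fun t => if M.κ = M.x then Y t else
      Y t - H * c.input (recv (onOffState net M.Active H) z) m t M.f)) 0 a = m a}

lemma measurableSet_decodingSet (hrelay : ∀ r t, Measurable (c.relay r t))
    (hdec : ∀ i, Measurable (c.dec i)) (z : ℕ × Node K ρ → ℂ) (m : Fin K → ℕ) :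
    MeasurableSet (decodingSet M c H z m) := by
  classical
  refine MeasurableSet.inter ?_ ?_
  · exact measurableSet_eq_fun (measurable_decoded_forcedRecv hrelay hdec _ z M.x 0 b)
      measurable_const
  · refine measurableSet_eq_fun ((measurable_decoded_forcedRecv hrelay hdec _ z M.κ 0 a).comp
      (measurable_pi_lambda _ fun t => ?_)) measurable_const
    split_ifs <;> fun_prop

/-- The condition at `D_b` involves `Y` alone, so `m b = m' b`. The correction subtracted for `D_a`
is the input of `f`, which depends on `m b` only; hence the condition at `D_a` also determines the
message. -/
lemma eq_of_mem_decodingSet {z : ℕ × Node K ρ → ℂ} {m m' : Fin K → ℕ} {Y : Fin N → ℂ}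
    (h : Y ∈ decodingSet M c H z m) (h' : Y ∈ decodingSet M c H z m') :
    m a = m' a ∧ m b = m' b := by
  have hb : m b = m' b := h.1.symm.trans h'.1
  refine ⟨?_, hb⟩
  rw [← h.2, ← h'.2]
  congr 2
  funext t
  congr 3
  exact input_eq_of_closed c M.SB_closed (fun _ _ _ => rfl)
    (fun i hi => by rw [M.SB_src i hi, hb]) t M.f_mem

/-- The two errors are considered for different noise realizations, with the same `y` placed at `x`
for `D_b` and at `κ` for `D_a`. The inputs of `p` and `f` come from sets avoiding both nodes, so
they agree with those under `z`, and one vector `Y` serves both destinations. -/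
lemma codeword_add_mem_decodingSet {m : Fin K → ℕ} {y : Fin N → ℂ} {z : ℕ × Node K ρ → ℂ}
    (hb : c.decoded (recv (onOffState net M.Active H) (inject M.x y z)) m b = m b)
    (ha : c.decoded (recv (onOffState net M.Active H) (inject M.κ y z)) m a = m a) :
    codeword M c H z m + y ∈ decodingSet M c H z m := by
  classical
  have hp : ∀ {v}, v ∉ M.SA → ∀ t : ℕ,
      c.input (recv (onOffState net M.Active H) (inject v y z)) m t M.p =
        c.input (recv (onOffState net M.Active H) z) m t M.p := fun {v} hv t =>
    input_eq_of_closed c M.SA_closed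
      (fun t u hu => inject_of_ne (ne_of_mem_of_not_mem hu hv) y z t) (fun _ _ => rfl) t M.p_mem
  have hf : ∀ {v}, v ∉ M.SB → ∀ t : ℕ,
      c.input (recv (onOffState net M.Active H) (inject v y z)) m t M.f =
        c.input (recv (onOffState net M.Active H) z) m t M.f := fun {v} hv t =>
    input_eq_of_closed c M.SB_closed
      (fun t u hu => inject_of_ne (ne_of_mem_of_not_mem hu hv) y z t) (fun _ _ => rfl) t M.f_mem
  have hx : ∀ t : Fin N, (codeword M c H z m + y) t = H * net.activeSum M.Active
      (c.input (recv (onOffState net M.Active H) (inject M.x y z)) m t) M.x + y t := by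
    intro t
    rw [activeSum_eq_add M.adj M.p_ne_f M.active_x, hp M.x_notMem_SA, hf M.x_notMem_SB]
    rfl
  refine ⟨?_, ?_⟩
  · rw [← hb]
    exact (decoded_inject_eq c M.TB_closed M.TB_src M.dst_mem_TB m y z _ hx).symm
  · rw [← ha]
    refine (decoded_inject_eq c M.TA_closed M.TA_src M.dst_mem_TA m y z _ fun t => ?_).symm
    by_cases hκ : M.κ = M.x
    · rw [if_pos hκ, hκ]
      exact hx t
    · rw [if_neg hκ, activeSum_eq_single M.adj ((M.active_κ hκ M.p).2 rfl)
        (fun u hu hne => absurd ((M.active_κ hκ u).1 hu) hne), hp M.κ_notMem_SA]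
      simp only [Pi.add_apply, codeword]
      ring

/-- The energy that the node `v` spends. -/
noncomputable def energy (h : net.Edge → ℂ) (m : Fin K → ℕ) (v : Node K ρ)
    (z : ℕ × Node K ρ → ℂ) : ℝ≥0∞ :=
  ∑ t ∈ Finset.range N, ‖c.input (recv h z) m t v‖ₑ ^ 2

variable {c} in
lemma measurable_energy (hrelay : ∀ r t, Measurable (c.relay r t)) (h : net.Edge → ℂ)
    (m : Fin K → ℕ) (v : Node K ρ) : Measurable (energy c h m v) := by
  refine Finset.measurable_sum _ fun t _ => ?_
  have := (NetCode.measurable_input hrelay (recv := fun z => recv h z)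
    (fun t v X hX => measurable_recv h measurable_id t v hX) m t v).2
  exact this.enorm.pow_const 2

/-- The inputs of `p` and `f` may be correlated, so only `|u + v| ^ 2 ≤ 2 (|u| ^ 2 + |v| ^ 2)` is
used: `2 * (16 + 16) = 64`. -/
lemma sum_norm_sq_codeword_le {z : ℕ × Node K ρ → ℂ} {m : Fin K → ℕ}
    (hp : energy c (onOffState net M.Active H) m M.p z ≤ 16 * N)
    (hf : energy c (onOffState net M.Active H) m M.f z ≤ 16 * N) :
    ∑ t, ‖codeword M c H z m t‖ ^ 2 ≤ 64 * N * ‖H‖ ^ 2 := by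
  set X : ℕ → Node K ρ → ℂ := fun t => c.input (recv (onOffState net M.Active H) z) m t
  have key : ∀ v, energy c (onOffState net M.Active H) m v z ≤ 16 * N →
      ∑ t : Fin N, ‖X t v‖ ^ 2 ≤ 16 * N := by
    intro v hv
    rw [energy, Finset.sum_range] at hv
    have h1 : ∀ t : Fin N, ‖X t v‖ₑ ^ 2 = ENNReal.ofReal (‖X t v‖ ^ 2) := fun t => by
      rw [ENNReal.ofReal_pow (norm_nonneg _), ofReal_norm]
    have h2 : (16 * N : ℝ≥0∞) = ENNReal.ofReal (16 * N) := by
      rw [ENNReal.ofReal_mul (by norm_num), ENNReal.ofReal_natCast]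
      norm_num
    rw [Finset.sum_congr rfl fun t _ => h1 t, ← ENNReal.ofReal_sum_of_nonneg
      (fun _ _ => by positivity), h2] at hv
    exact (ENNReal.ofReal_le_ofReal_iff (by positivity)).1 hv
  have h1 := key _ hp
  have h2 := key _ hf
  calc _ ≤ ∑ t : Fin N, ‖H‖ ^ 2 * (2 * (‖X t M.p‖ ^ 2 + ‖X t M.f‖ ^ 2)) := by
        refine Finset.sum_le_sum fun t _ => ?_
        rw [codeword, norm_mul, mul_pow]
        refine mul_le_mul_of_nonneg_left ?_ (by positivity)
        calc _ ≤ (‖X t M.p‖ + ‖X t M.f‖) ^ 2 :=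
              pow_le_pow_left₀ (norm_nonneg _) (norm_add_le _ _) 2
          _ ≤ _ := add_sq_le
    _ = ‖H‖ ^ 2 * (2 * (∑ t : Fin N, ‖X t M.p‖ ^ 2 + ∑ t : Fin N, ‖X t M.f‖ ^ 2)) := by
        rw [← Finset.mul_sum, ← Finset.mul_sum, Finset.sum_add_distrib]
    _ ≤ ‖H‖ ^ 2 * (2 * (16 * N + 16 * N)) := by gcongr
    _ = _ := by ring

include M in
/-- The number of message pairs is bounded by the volume bound, up to the decoding errors and the
energy violations. -/
lemma card_le_add_sum (hH : H ≠ 0) (hrelay : ∀ r t, Measurable (c.relay r t))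
    (hdec : ∀ i, Measurable (c.dec i)) (F : Finset (Fin K → ℕ))
    (hF : ∀ m ∈ F, ∀ m' ∈ F, m a = m' a → m b = m' b → m = m') :
    (F.card : ℝ≥0∞) ≤ ENNReal.ofReal ((1 + ‖H‖ ^ 2) ^ N * Real.exp (64 * N)) +
      (∑ m ∈ F, noise K ρ
        {z | c.decoded (recv (onOffState net M.Active H) z) m a ≠ m a} +
      ∑ m ∈ F, noise K ρ
        {z | c.decoded (recv (onOffState net M.Active H) z) m b ≠ m b} +
      (∑ m ∈ F, noise K ρ {z | 16 * N ≤ energy c (onOffState net M.Active H) m M.p z} +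
      ∑ m ∈ F, noise K ρ {z | 16 * N ≤ energy c (onOffState net M.Active H) m M.f z})) := by
  classical
  set h := onOffState net M.Active H
  set γ : Measure (Fin N → ℂ) := Measure.pi fun _ => complexGaussian
  have hS : 0 < ‖H‖ ^ 2 := by positivity
  let Ea : (Fin K → ℕ) → Set (ℕ × Node K ρ → ℂ) := fun m => {z | c.decoded (recv h z) m a ≠ m a}
  let Eb : (Fin K → ℕ) → Set (ℕ × Node K ρ → ℂ) := fun m => {z | c.decoded (recv h z) m b ≠ m b}
  let Pp : (Fin K → ℕ) → Set (ℕ × Node K ρ → ℂ) := fun m => {z | 16 * N ≤ energy c h m M.p z}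
  let Pf : (Fin K → ℕ) → Set (ℕ × Node K ρ → ℂ) := fun m => {z | 16 * N ≤ energy c h m M.f z}
  have hE : ∀ m i, MeasurableSet {z | c.decoded (recv h z) m i ≠ m i} := fun m i =>
    (measurableSet_eq_fun (NetCode.measurable_decoded hrelay hdec (recv := fun z => recv h z)
      (fun t v X hX => measurable_recv h measurable_id t v hX) m i) measurable_const).compl
  have hPm : ∀ m v, MeasurableSet {z | (16 * N : ℝ≥0∞) ≤ energy c h m v z} := fun m v =>
    measurableSet_le measurable_const (measurable_energy hrelay h m v)
  let Ta : (Fin N → ℂ) × (ℕ × Node K ρ → ℂ) → ℕ × Node K ρ → ℂ := fun p => inject M.κ p.1 p.2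
  let Tb : (Fin N → ℂ) × (ℕ × Node K ρ → ℂ) → ℕ × Node K ρ → ℂ := fun p => inject M.x p.1 p.2
  have hTa : MeasurePreserving Ta (γ.prod (noise K ρ)) (noise K ρ) := measurePreserving_inject N M.κ
  have hTb : MeasurePreserving Tb (γ.prod (noise K ρ)) (noise K ρ) := measurePreserving_inject N M.x
  -- The good event for `m`: both destinations decode correctly, each with `y` at its own node, and
  -- `p` and `f` respect the energy bound. Each injected noise has the right law separately, so the
  -- union bound needs only the original error probabilities.
  let G : (Fin K → ℕ) → Set ((Fin N → ℂ) × (ℕ × Node K ρ → ℂ)) := fun m =>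
    (Ta ⁻¹' Ea m ∪ Tb ⁻¹' Eb m ∪ (Prod.snd ⁻¹' Pp m ∪ Prod.snd ⁻¹' Pf m))ᶜ
  have hG : ∀ m, MeasurableSet (G m) := fun m =>
    (((hTa.measurable (hE m a)).union (hTb.measurable (hE m b))).union
      ((measurable_snd (hPm m M.p)).union (measurable_snd (hPm m M.f)))).compl
  have h1 : ∀ m, (1 : ℝ≥0∞) ≤ γ.prod (noise K ρ) (G m) + (noise K ρ (Ea m) + noise K ρ (Eb m) +
      (noise K ρ (Pp m) + noise K ρ (Pf m))) := by
    intro m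
    have hsnd : MeasurePreserving Prod.snd (γ.prod (noise K ρ)) (noise K ρ) :=
      measurePreserving_snd
    rw [← hTa.measure_preimage (hE m a).nullMeasurableSet,
      ← hTb.measure_preimage (hE m b).nullMeasurableSet,
      ← hsnd.measure_preimage (hPm m M.p).nullMeasurableSet,
      ← hsnd.measure_preimage (hPm m M.f).nullMeasurableSet]
    calc (1 : ℝ≥0∞) = γ.prod (noise K ρ) Set.univ := measure_univ.symm
      _ ≤ γ.prod (noise K ρ) (G m ∪ (Ta ⁻¹' Ea m ∪ Tb ⁻¹' Eb m ∪
          (Prod.snd ⁻¹' Pp m ∪ Prod.snd ⁻¹' Pf m))) := by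
        rw [Set.compl_union_self]
      _ ≤ _ := (measure_union_le _ _).trans (add_le_add_right ((measure_union_le _ _).trans
        (add_le_add (measure_union_le _ _) (measure_union_le _ _))) _)
  -- For fixed `z` the codewords are deterministic and `y` is the only noise, so the decoding bound
  -- applies with `S = ‖H‖ ^ 2`. Tuples that violate the energy bound at this `z` contribute
  -- nothing.
  have h2 : ∑ m ∈ F, γ.prod (noise K ρ) (G m) ≤
      ENNReal.ofReal ((1 + ‖H‖ ^ 2) ^ N * Real.exp (64 * N)) := by
    simp only [Measure.prod_apply_symm (hG _)]
    rw [← lintegral_finsetSum' _ fun m _ => (measurable_measure_prodMk_right (hG m)).aemeasurable]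
    refine (lintegral_mono (g := fun _ =>
      ENNReal.ofReal ((1 + ‖H‖ ^ 2) ^ N * Real.exp (64 * N))) fun z => ?_).trans (by simp)
    let F' := F.filter fun m => energy c h m M.p z ≤ 16 * N ∧ energy c h m M.f z ≤ 16 * N
    have hzero : ∀ m ∈ F, m ∉ F' → γ ((fun y => (y, z)) ⁻¹' G m) = 0 := by
      intro m hm hm'
      have : (fun y => (y, z)) ⁻¹' G m = ∅ := by
        refine Set.eq_empty_iff_forall_notMem.2 fun y hy => hm' ?_
        simp only [G, Set.mem_preimage, Set.mem_compl_iff, Set.mem_union, not_or] at hy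
        exact Finset.mem_filter.2 ⟨hm, (not_le.1 hy.2.1).le, (not_le.1 hy.2.2).le⟩
      rw [this, measure_empty]
    rw [← Finset.sum_subset (Finset.filter_subset _ F) hzero]
    calc _ ≤ ∑ m ∈ F', γ ((codeword M c H z m + ·) ⁻¹' decodingSet M c H z m) := by
          refine Finset.sum_le_sum fun m hm => measure_mono fun y hy => ?_
          simp only [G, Set.mem_preimage, Set.mem_compl_iff, Set.mem_union, not_or] at hy
          exact codeword_add_mem_decodingSet M c (not_not.1 hy.1.2) (not_not.1 hy.1.1)
      _ ≤ _ := sum_measure_decoded_le F' _ _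
          (fun m _ => measurableSet_decodingSet M c hrelay hdec z m) ?_ hS (P := 64 * N * ‖H‖ ^ 2)
          (fun m hm => sum_norm_sq_codeword_le M c (Finset.mem_filter.1 hm).2.1
            (Finset.mem_filter.1 hm).2.2)
      _ = _ := by rw [mul_div_cancel_right₀ _ hS.ne']
    intro m hm m' hm' hne
    refine Set.disjoint_left.2 fun Y hY hY' => hne ?_
    obtain ⟨e1, e2⟩ := eq_of_mem_decodingSet M c hY hY'
    exact hF m (Finset.mem_filter.1 hm).1 m' (Finset.mem_filter.1 hm').1 e1 e2
  calc (F.card : ℝ≥0∞) = ∑ m ∈ F, 1 := by simp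
    _ ≤ _ := Finset.sum_le_sum fun m _ => h1 m
    _ = _ := by
      rw [Finset.sum_add_distrib, Finset.sum_add_distrib, Finset.sum_add_distrib,
        Finset.sum_add_distrib]
    _ ≤ _ := add_le_add_left h2 _

/-- Markov's inequality: mean energy below `2 N` on average over the messages, against the threshold
`16 N`, gives the fraction `1/8`. -/
lemma sum_energy_le {h : net.Edge → ℂ} {R : Fin K → ℝ} {v : Node K ρ} (hN : 1 ≤ N)
    (hrelay : ∀ r t, Measurable (c.relay r t)) (hR : ∀ i, 0 ≤ R i)
    (hpow : avgPower h c R v < 2) :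
    ∑ m ∈ messages N R, noise K ρ {z | 16 * N ≤ energy c h m v z} ≤
      ENNReal.ofReal ((messages N R).card / 8) := by
  have hcard := messages_card_pos (N := N) hR
  have hN0 : (16 * N : ℝ≥0∞) ≠ 0 := by
    have : (N : ℝ≥0∞) ≠ 0 := by exact_mod_cast (by omega : N ≠ 0)
    simpa using this
  have hNt : (16 * N : ℝ≥0∞) ≠ ∞ := ENNReal.mul_ne_top (by norm_num) (ENNReal.natCast_ne_top N)
  calc _ ≤ ∑ m ∈ messages N R, (∫⁻ z, energy c h m v z ∂(noise K ρ)) / (16 * N) :=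
        Finset.sum_le_sum fun m _ => meas_ge_le_lintegral_div
          (measurable_energy hrelay h m v).aemeasurable hN0 hNt
    _ = (∑ m ∈ messages N R, ∫⁻ z, energy c h m v z ∂(noise K ρ)) / (16 * N) := by
        simp only [div_eq_mul_inv, Finset.sum_mul]
    _ ≤ (2 * (N * (messages N R).card)) / (16 * N) := by
        refine ENNReal.div_le_div_right ?_ _
        have h0 : ((N : ℝ≥0∞) * (messages N R).card) ≠ 0 := by
          exact_mod_cast Nat.mul_ne_zero (by omega) hcard.ne'
        have ht : ((N : ℝ≥0∞) * (messages N R).card) ≠ ∞ :=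
          ENNReal.mul_ne_top (ENNReal.natCast_ne_top _) (ENNReal.natCast_ne_top _)
        exact (ENNReal.div_le_iff h0 ht).1 hpow.le
    _ = ENNReal.ofReal ((messages N R).card / 8) := by
        have hN' : (0 : ℝ) < N := by exact_mod_cast hN
        have e1 : (2 * (N * (messages N R).card) : ℝ≥0∞) =
            ENNReal.ofReal (2 * (N * (messages N R).card)) := by
          rw [ENNReal.ofReal_mul (by norm_num), ENNReal.ofReal_mul (by positivity),
            ENNReal.ofReal_natCast, ENNReal.ofReal_natCast]
          norm_num
        have e2 : (16 * N : ℝ≥0∞) = ENNReal.ofReal (16 * N) := by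
          rw [ENNReal.ofReal_mul (by norm_num), ENNReal.ofReal_natCast]
          norm_num
        rw [e1, e2, ← ENNReal.ofReal_div_of_pos (by positivity)]
        congr 1
        field_simp
        ring

include M in
lemma rate_add_rate_le (hab : a ≠ b) (hH : H ≠ 0) {c : (N : ℕ) → NetCode K ρ ℂ N}
    {R : Fin K → ℝ} (h : Reliable (onOffState net M.Active H) c R) :
    R a + R b ≤ Real.logb 2 (1 + ‖H‖ ^ 2) + 64 / Real.log 2 := by
  have hzero : ∀ i, i ≠ a → i ≠ b → R i = 0 := fun i hia hib =>
    rate_eq_zero_of_silent (M.not_active_src hia hib) h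
  obtain ⟨hrelay, hdec, hpow, hR, herr⟩ := h
  -- Two decoding errors and two energy violations at `1/8` each discard at most half of the tuples,
  -- whence the constant `2`.
  refine rate_add_le (c := 2) (hR a) (hR b) ?_
  have hpow' : ∀ v, ∀ᶠ N in atTop, avgPower (onOffState net M.Active H) (c N) R v < 2 := fun v =>
    eventually_lt_of_limsup_lt ((hpow v).trans_lt (by norm_num))
  have herr' : ∀ i, ∀ᶠ N in atTop, errorProb (onOffState net M.Active H) (c N) R i < 1 / 8 :=
    fun i => (herr i).eventually (gt_mem_nhds (by norm_num))
  filter_upwards [hpow' M.p, hpow' M.f, herr' a, herr' b, eventually_ge_atTop 1] with N hp hf ha hb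
    hN
  rw [← messages_card_of_two hab hzero]
  have hpos : (0 : ℝ) < (messages N R).card := by exact_mod_cast messages_card_pos hR
  have hsum : ∀ i, errorProb (onOffState net M.Active H) (c N) R i < 1 / 8 →
      ∑ m ∈ messages N R, noise K ρ
        {z | (c N).decoded (recv (onOffState net M.Active H) z) m i ≠ m i} ≤
        ENNReal.ofReal ((messages N R).card / 8) := by
    intro i hi
    rw [errorProb, div_lt_iff₀ hpos] at hi
    rw [← ENNReal.ofReal_toReal (a := ∑ m ∈ messages N R, _)
      (ENNReal.sum_ne_top.2 fun m _ => measure_ne_top _ _),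
      ENNReal.toReal_sum fun m _ => measure_ne_top _ _]
    refine ENNReal.ofReal_le_ofReal ?_
    have : ∑ m ∈ messages N R, (noise K ρ
      {z | (c N).decoded (recv (onOffState net M.Active H) z) m i ≠ m i}).toReal ≤
      1 / 8 * (messages N R).card := hi.le
    linarith
  have key := card_le_add_sum M (c N) hH (hrelay N) (hdec N) (messages N R)
    (fun m hm m' hm' => messages_ext hzero hm hm')
  have key2 := key.trans (add_le_add_right (add_le_add (add_le_add (hsum a ha) (hsum b hb))
    (add_le_add (sum_energy_le (c N) hN (hrelay N) hR hp)
      (sum_energy_le (c N) hN (hrelay N) hR hf))) _)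
  rw [← ENNReal.ofReal_add (by positivity) (by positivity),
    ← ENNReal.ofReal_add (by positivity) (by positivity),
    ← ENNReal.ofReal_add (by positivity) (by positivity), ← ENNReal.ofReal_natCast,
    ENNReal.ofReal_le_ofReal_iff (by positivity)] at key2
  have hK : (1 + ‖H‖ ^ 2) ^ N * Real.exp (64 * N) =
      2 ^ (N * (Real.logb 2 (1 + ‖H‖ ^ 2) + 64 / Real.log 2)) := by
    have hl : 0 < Real.log 2 := Real.log_pos one_lt_two
    have h1 : (0 : ℝ) < 1 + ‖H‖ ^ 2 := by positivity
    rw [Real.rpow_def_of_pos two_pos, ← Real.exp_log (pow_pos h1 N), ← Real.exp_add, Real.log_pow,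
      Real.logb]
    congr 1
    field_simp
  rw [hK] at key2
  linarith

end Gauss

/-! ### The bound for the Gaussian model and the conclusion -/

namespace LayeredNetwork

variable {K : ℕ} {ρ : Type*} [Fintype ρ] {net : LayeredNetwork K ρ}

lemma GaussAchievable.le_half {a b : Fin K} (hab : a ≠ b) (M : net.MeetingFlows a b) {α : ℝ}
    (h : net.GaussAchievable 1 α) : α ≤ 1 / 2 := by
  classical
  rcases le_or_gt α 0 with hα | hα
  · linarith
  obtain ⟨τ, h⟩ := h
  obtain ⟨ra, hra, hra'⟩ := M.route_a
  obtain ⟨rb, hrb, hrb'⟩ := M.route_b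
  have wa := M.activeWithout_of_isPath hab hra hra'
  have wb := M.activeWithout_of_isPath hab.symm hrb hrb'
  -- For fixed `d`, the spacing `g` and hence `B` are constants, and letting `k` grow compares the
  -- coefficients of `2 * k`.
  have hfrac : ∀ d : ℕ, 4 ≤ d → 2 * α * (1 - 2 / d) ≤ 1 := by
    intro d hd
    obtain ⟨g, hg, htail⟩ := Gauss.exists_complexGaussian_tail_le
      (ε := (1 / 2) ^ (d * (Fintype.card (Node K ρ) + 1))) (by positivity)
    have hg' : (1 : ℝ) ≤ g := by exact_mod_cast hg
    set B : ℝ := Real.logb 2 (5 * g ^ 2) + 64 / Real.log 2 + 2 * τ with hB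
    have key : ∀ k : ℕ, 2 ≤ k → 2 * (α * (2 * k * (1 - 2 / d) - 2)) ≤ 2 * k + B := by
      intro k hk
      set H : ℂ := ((2 * 2 ^ k * g : ℕ) : ℂ) with hHdef
      have hH : H ≠ 0 := by
        rw [hHdef, Nat.cast_ne_zero]
        positivity
      have h1 := h.two_mul_le hα.le (s := Gauss.onOffState net M.Active H)
        (sa := Gauss.onOffState net (M.ActiveWithout b) H)
        (sb := Gauss.onOffState net (M.ActiveWithout a) H) (a := a) (b := b)
        (sameView_activeWithout M hab H 0) (sameView_activeWithout M hab.symm H 0)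
        (fun c R hc i hi => Gauss.rate_eq_zero_of_silent (M.not_activeWithout_right hi) hc)
        (fun c R hc i hi => Gauss.rate_eq_zero_of_silent (M.not_activeWithout_left hi) hc)
        (Gauss.le_sumCapacity_of_route (fun u v h => M.adj u v h.1) hra wa hd hk hg htail)
        (Gauss.le_sumCapacity_of_route (fun u v h => M.adj u v h.1) hrb wb hd hk hg htail)
        (fun c R hc => Gauss.rate_add_rate_le M hab hH hc)
      -- Here `‖H‖ ^ 2 = 4 g ^ 2 (2 ^ k) ^ 2`, and the summand `1` is absorbed by a fifth copy of `g
      -- ^ 2 (2 ^ k) ^ 2`.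
      have hnorm : 1 + ‖H‖ ^ 2 ≤ 5 * g ^ 2 * 2 ^ (2 * k : ℝ) := by
        have h2 : (2 : ℝ) ^ (2 * k : ℝ) = (2 ^ k) ^ 2 := by
          rw [← pow_mul, mul_comm k 2, ← Real.rpow_natCast]
          push_cast
          rfl
        have h3 : (1 : ℝ) ≤ 2 ^ k := one_le_pow₀ one_le_two
        rw [hHdef, Complex.norm_natCast, h2]
        push_cast
        have h4 : 1 ≤ (2 ^ k * (g : ℝ)) ^ 2 := one_le_pow₀ (one_le_mul_of_one_le_of_one_le h3 hg')
        nlinarith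
      have hlog : Real.logb 2 (1 + ‖H‖ ^ 2) ≤ Real.logb 2 (5 * g ^ 2) + 2 * k := by
        refine (Real.logb_le_logb_of_le one_lt_two (by positivity) hnorm).trans (le_of_eq ?_)
        rw [Real.logb_mul (by positivity) (by positivity), Real.logb_rpow two_pos (by norm_num)]
      linarith
    by_contra hlt
    push Not at hlt
    have hpos : 0 < 2 * α * (1 - 2 / d) - 1 := by linarith
    obtain ⟨n, hn⟩ := exists_nat_gt ((B + 4 * α) / (2 * (2 * α * (1 - 2 / d) - 1)))
    rw [div_lt_iff₀ (by linarith)] at hn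
    have := key (n + 2) (by omega)
    push_cast at this
    nlinarith
  by_contra hlt
  push Not at hlt
  -- Letting `d` grow removes the loss `2 / d` of the error-correcting code.
  obtain ⟨n, hn⟩ := exists_nat_gt (4 * α / (2 * α - 1))
  have hpos : 0 < 2 * α - 1 := by linarith
  rw [div_lt_iff₀ hpos] at hn
  have h1 := hfrac (n + 4) (by omega)
  have hn4 : (0 : ℝ) < ((n + 4 : ℕ) : ℝ) := by positivity
  have h2 : 2 * α * (1 - 2 / ((n + 4 : ℕ) : ℝ)) = (2 * α * ((n + 4 : ℕ) : ℝ) - 4 * α) /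
      ((n + 4 : ℕ) : ℝ) := by
    field_simp
    ring
  rw [h2, div_le_one hn4] at h1
  push_cast at h1
  nlinarith

end LayeredNetwork

theorem lemma1 {K : ℕ} {ρ : Type*} [Fintype ρ] (net : LayeredNetwork K ρ) (i j : Fin K)
    (hij : i ≠ j)
    (hpath : ∃ p, net.IsRoute (.src i) (.dst j) p ∧ ∀ v ∈ p, ∃ k, net.OnRoute k k v) :
    net.linDetNormalizedSumCapacity 1 ≤ ((1 / 2 : ℝ) : EReal) ∧
      net.gaussNormalizedSumCapacity 1 ≤ ((1 / 2 : ℝ) : EReal) := by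
  obtain ⟨b, hib, ⟨M⟩⟩ := LayeredNetwork.exists_meetingFlows hij hpath
  constructor
  · refine sSup_le ?_
    rintro _ ⟨α, hα, rfl⟩
    exact EReal.coe_le_coe_iff.2 (hα.le_half hib M)
  · refine sSup_le ?_
    rintro _ ⟨α, hα, rfl⟩
    exact EReal.coe_le_coe_iff.2 (hα.le_half hib M)
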